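/- **Setting.** Let $m,n,C$ be positive integers, $N=mn$, with $n<C<N$, and put $\tilde n=C-n$; assume $\tilde n\ge cn$ for a constant $c>0$ ($m$ machines, each able to store at most $C$ of the functions). Let $f_1,\dots,f_N:\mathbb R^d\to\mathbb R$ be convex and differentiable with $\|\nabla f_i(x)-\nabla f_i(y)\|\le L\|x-y\|$, let $f=\frac1N\sum_{i=1}^N f_i$ be $\mu$-strongly convex, in the sense that $\|\nabla f(x)-\nabla f(y)\|\ge\mu\|x-y\|$ for all $x,y$, where $L,\mu>0$, let $x^*$ be the minimizer of $f$, and let $\kappa=L/\mu$. A random point $\hat x$ is $\epsilon$-optimal if $\mathbb E[f(\hat x)-f(x^*)]\le\epsilon$. **Algorithm DASVRG** with parameters $\eta,T,K,P,\sigma$ and initial point $\hat x_0$. *Data allocation:* put $Q=TKP$. Let $i_1,\dots,i_N$ be a uniformly random permutation of $[N]$ and $S_j=\{i_{(j-1)n+1},\dots,i_{jn}\}$. Independently for each $\ell\le Q$, let $r_\ell=i_\ell$ with probability $1-\frac{\ell-1}N$ and $r_\ell=i_{\ell'}$ with probability $\frac1N$ for each $\ell'<\ell$ (for $\ell>N$,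 $r_\ell$ is uniform on $[N]$). The multi-sets $R_1,R_2,\dots$ are the consecutive blocks of length $\tilde n$ of $r_1,\dots,r_Q$, the last nonempty one possibly being shorter. Machine $j$ stores $f_i$ for $i\in S_j\cup R_j$. Machine $k=1$ is active first. *Outer loop:* put $q=\frac{\mu}{\mu+\sigma}$, $y_0=\hat x_0$, $\alpha_0=\sqrt q$. For $p=1,\dots,P$ let $\tilde f_i(x)=f_i(x)+\frac\sigma2\|x-y_{p-1}\|^2$, send $y_{p-1}$ to the machines, start from $\tilde x^0=\hat x_{p-1}$ and, for $\ell=0,\dots,K-1$, broadcast $\tilde x^\ell$, compute the batch gradient $h=\frac1N\sum_{j=1}^m\sum_{i\in S_j}\nabla\tilde f_i(\tilde x^\ell)$ (machine $j$ sends its inner sum to the center, which sends $h$ to the active machine), and obtain $\tilde x^{\ell+1}$ by a call of SS-SVRG. Then $\hat x_p=\tilde x^K$ is sent to the center, $\alpha_p\in(0,1)$ solves $\alpha_p^2=(1-\alpha_p)\alpha_{p-1}^2+q\alpha_p$, and $y_p=\hat x_p+\beta_p(\hat x_p-\hat x_{p-1})$ with $\beta_p=\frac{\alpha_{p-1}(1-\alpha_{p-1})}{\alpha_{p-1}^2+\alpha_p}$.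 The output is $\hat x_P$. *SS-SVRG:* put $x_0=\tilde x^\ell$; for $t=0,\dots,T-1$ the active machine $k$ draws $i$ uniformly from $R_k$, sets $x_{t+1}=x_t-\eta(\nabla\tilde f_i(x_t)-\nabla\tilde f_i(\tilde x^\ell)+h)$ and removes (one copy of) $i$ from $R_k$; if $R_k$ is now empty, the iterate and the running average are sent to machine $k+1$, which becomes active. The result is $\frac1T\sum_{t=1}^Tx_t$. Every exchange of messages listed here counts as a round of communication (the initial data allocation is not counted). **Theorem.** Take $\sigma=\frac Ln$, $\eta=\frac1{16L}$, $q=\frac\mu{\mu+\sigma}$, $$T=\Big\lceil 96\,\frac{L+\sigma}{\mu+\sigma}\Big\rceil,\qquad K=\left\lceil\frac1{\log(9/8)}\log\left(\frac4{2-\sqrt q}+\frac{10368\,\sigma}{\mu q(1-\frac{\sqrt q}2)^2}\right)\right\rceil ,$$ and, for $\epsilon>0$, let $$b_\epsilon=\Big(1+\sqrt{\tfrac\kappa n}\Big)\Big(1+\log\big(1+\tfrac\kappa n\big)\Big)\Big(1+\log^+\tfrac{f(\hat x_0)-f(x^*)}{\epsilon}\Big),\qquad \log^+ t=\max(0,\log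 t)\ (\log^+0=0).$$ There are an absolute constant $A$ and a constant $B$ depending only on $c$ such that, for all data as above, every $\hat x_0\in\mathbb R^d$ and every $\epsilon>0$, there is an integer $P_0\ge0$ with $KP_0\le A\,b_\epsilon$ such that: 1. for every $P\ge P_0$ with $TKP\le\tilde nm$, the output $\hat x_P$ of DASVRG with $P$ outer iterations is $\epsilon$-optimal; 2. if $TKP_0\le\tilde nm$, then DASVRG with $P_0$ outer iterations always makes exactly $KP_0\le A\,b_\epsilon$ calls of SS-SVRG and uses at most $B\,b_\epsilon$ rounds of communication. That is, DASVRG finds an $\epsilon$-optimal solution after $O\big((1+\sqrt{\kappa/n})(1+\log(1+\kappa/n))\log(1/\epsilon)\big)$ calls of SS-SVRG and $\tilde O\big((1+\sqrt{\kappa/n})\log(1/\epsilon)\big)$ rounds of communication, where the optimality gap of $\hat x_0$ is treated as a constant and $\tilde O$ hides the factor $1+\log(1+\kappa/n)$. -/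

import Mathlib

open scoped Gradient ENNReal

noncomputable section

namespace DASVRG

/-- The Euclidean space `ℝᵈ`. -/
abbrev Vec (d : ℕ) : Type := EuclideanSpace ℝ (Fin d)

/-- The objective `f = (1/N) ∑ i, f i`. -/
def objective {d N : ℕ} (f : Fin N → Vec d → ℝ) (x : Vec d) : ℝ :=
  (1 / (N : ℝ)) * ∑ i, f i x

/-- The proximal data `f i x + (σ/2) ‖x - y‖²` with proximal point `y`. -/
def proxData {d N : ℕ} (f : Fin N → Vec d → ℝ) (σ : ℝ) (y : Vec d) (i : Fin N) (x : Vec d) : ℝ :=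
  f i x + σ / 2 * ‖x - y‖ ^ 2

/-- A `for` loop with a randomized body: `body 0`, then `body 1`, up to `body (n - 1)`. -/
def loop {α : Type} (body : ℕ → α → PMF α) : ℕ → α → PMF α
  | 0, s => PMF.pure s
  | n + 1, s => (loop body n s).bind (body n)

/-- What the network of machines keeps track of. Machines are numbered from `0`. -/
structure Network (N : ℕ) where
  /-- the multi-sets `R j` of unused sampled indices -/
  samples : ℕ → Multiset (Fin N)
  /-- the active machine `k` -/
  active : ℕ
  /-- the number of calls of the single-stage SVRG subroutine so far -/
  calls : ℕ
  /-- the number of rounds of communication so far -/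
  rounds : ℕ

/-- Add `r` rounds of communication to the count. -/
def Network.communicate {N : ℕ} (w : Network N) (r : ℕ) : Network N :=
  { w with rounds := w.rounds + r }

/-- Data allocation, for `N = m * n` data points on `m` machines with room for `nt` samples each.
The output is the random partition `S j` (`j < m`) and the multi-sets `R j`.

`π` is a uniformly random permutation `i_0, …, i_{N-1}` of the indices, cut into `m` consecutive
blocks `S j` of length `n`. With `u ℓ` uniform on `{0, …, N-1}`, the sample `r ℓ = i_{min ℓ (u ℓ)}`
is `i_ℓ` with probability `1 - ℓ / N` and is `i_a` with probability `1 / N` for each `a < ℓ`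
(`ℓ` counted from `0`; for `ℓ ≥ N` it is uniform on all the indices). The sequence `r` is cut into
consecutive blocks `R j` of length `nt`, the last nonempty one possibly being shorter. -/
def dataAllocation (m n nt Q : ℕ) [NeZero m] [NeZero n] :
    PMF ((Fin m → Finset (Fin (m * n))) × (ℕ → Multiset (Fin (m * n)))) :=
  (PMF.uniformOfFintype (Equiv.Perm (Fin (m * n)))).bind fun π =>
  (PMF.uniformOfFintype (Fin Q → Fin (m * n))).bind fun u =>
    let r : Fin Q → Fin (m * n) := fun ℓ =>
      π ⟨min ℓ.val (u ℓ).val, lt_of_le_of_lt (min_le_right _ _) (u ℓ).isLt⟩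
    PMF.pure
      (fun j => (Finset.univ.filter fun a : Fin (m * n) => a.val / n = j.val).image π,
        fun j => (Finset.univ.filter fun ℓ : Fin Q => ℓ.val / nt = j).val.map r)

/-- The variables of a single stage: the iterate `x_t`, the running average of the iterates,
and the network. -/
structure InnerState (d N : ℕ) where
  x : Vec d
  avg : Vec d
  net : Network N

/-- The iterative update number `t` of a single stage: machine `k` draws an index `i` uniformly from
the multi-set `R k`, updates the iterate and the running average, and removes (one copy of) `i`
from `R k`. When `R k` has become empty, the iterate and the average are sent to machine `k + 1`,
which is one round of communication. (An update that finds `R k` empty does nothing.) -/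
def innerUpdate {d N : ℕ} (g : Fin N → Vec d → ℝ) (xref h : Vec d) (η : ℝ) (t : ℕ)
    (s : InnerState d N) : PMF (InnerState d N) :=
  if hR : s.net.samples s.net.active = 0 then PMF.pure s
  else (PMF.ofMultiset (s.net.samples s.net.active) hR).bind fun i =>
    let x' : Vec d := s.x - η • (∇ (g i) s.x - ∇ (g i) xref + h)
    let avg' : Vec d := (1 / ((t : ℝ) + 1)) • (x' + (t : ℝ) • s.avg)
    let Rk := (s.net.samples s.net.active).erase i
    let net' : Network N :=
      { s.net with samples := Function.update s.net.samples s.net.active Rk }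
    PMF.pure
      { x := x'
        avg := avg'
        net := if Rk = 0 then { net' with active := net'.active + 1, rounds := net'.rounds + 1 }
          else net' }

/-- Single-stage SVRG (SS-SVRG) with data `g`, reference point `xref`, batch gradient `h`,
step length `η` and `T` iterative updates; the output is the average of the iterates
`x_1, …, x_T` and the updated network. -/
def ssSVRG {d N : ℕ} (g : Fin N → Vec d → ℝ) (xref h : Vec d) (η : ℝ) (T : ℕ) (w : Network N) :
    PMF (Vec d × Network N) :=
  (loop (innerUpdate g xref h η) T ⟨xref, 0, w⟩).bind fun s =>
    PMF.pure (s.avg, { s.net with calls := s.net.calls + 1 })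

/-- One stage of distributed SVRG with data `g`. Three exchanges of messages are counted before the
call of SS-SVRG: the center sends `xref` to all machines, machine `j` sends
`∑ i ∈ S j, ∇ (g i) xref` to the center, and the center sends the batch gradient to the active
machine. -/
def stage {d N m : ℕ} (g : Fin N → Vec d → ℝ) (S : Fin m → Finset (Fin N)) (η : ℝ) (T : ℕ)
    (s : Vec d × Network N) : PMF (Vec d × Network N) :=
  let h : Vec d := (1 / (N : ℝ)) • ∑ j, ∑ i ∈ S j, ∇ (g i) s.1
  ssSVRG g s.1 h η T (s.2.communicate 3)

/-- The positive solution `α` of `α² = (1 - α) a² + q α`. -/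
def nextAlpha (q a : ℝ) : ℝ :=
  ((q - a ^ 2) + √((q - a ^ 2) ^ 2 + 4 * a ^ 2)) / 2

theorem eq_nextAlpha_iff {q a : ℝ} (hq1 : q < 1) (ha : 0 < a) (α : ℝ) :
    (α ∈ Set.Ioo (0 : ℝ) 1 ∧ α ^ 2 = (1 - α) * a ^ 2 + q * α) ↔ α = nextAlpha q a := by
  have hD : 0 < (q - a ^ 2) ^ 2 + 4 * a ^ 2 := by positivity
  have hs := Real.sq_sqrt hD.le
  have hs0 : 0 < √((q - a ^ 2) ^ 2 + 4 * a ^ 2) := Real.sqrt_pos.2 hD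
  have hlt : |q - a ^ 2| < √((q - a ^ 2) ^ 2 + 4 * a ^ 2) := by
    rw [← Real.sqrt_sq_eq_abs]
    exact Real.sqrt_lt_sqrt (sq_nonneg _) (by nlinarith [pow_pos ha 2])
  unfold nextAlpha
  generalize √((q - a ^ 2) ^ 2 + 4 * a ^ 2) = s at *
  obtain ⟨h1, h2⟩ := abs_lt.1 hlt
  constructor
  · rintro ⟨⟨h0, -⟩, h⟩
    have : (2 * α - (q - a ^ 2) - s) * (2 * α - (q - a ^ 2) + s) = 0 := by nlinarith
    rcases mul_eq_zero.1 this with h' | h'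
    · linarith
    · exfalso; nlinarith
  · rintro rfl
    refine ⟨⟨by linarith, ?_⟩, by nlinarith⟩
    have : s < 2 - (q - a ^ 2) ∨ 2 - (q - a ^ 2) ≤ s := lt_or_ge _ _
    rcases this with h | h
    · linarith
    · exfalso
      have hp : 0 < 2 - (q - a ^ 2) := by nlinarith [pow_pos ha 2]
      nlinarith

/-- The variables of the outer loop: the approximate solution `x̂_p`, the proximal point `y_p`,
the parameter `α_p` and the network. -/
structure OuterState (d N : ℕ) where
  x : Vec d
  y : Vec d
  α : ℝ
  net : Network N

/-- One outer iteration: `K` stages of distributed SVRG on the proximal data with proximal point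
`y_{p-1}`, started at `x̂_{p-1}`, followed by the extrapolation. Sending `y_{p-1}` to the machines
and sending `x̂_p` to the center are counted as one exchange of messages each. -/
def outerIteration {d N m : ℕ} (f : Fin N → Vec d → ℝ) (S : Fin m → Finset (Fin N))
    (q σ η : ℝ) (T K : ℕ) (s : OuterState d N) : PMF (OuterState d N) :=
  (loop (fun _ => stage (proxData f σ s.y) S η T) K (s.x, s.net.communicate 1)).bind fun z =>
    let α' := nextAlpha q s.α
    let β := s.α * (1 - s.α) / (s.α ^ 2 + α')
    PMF.pure
      { x := z.1
        y := z.1 + β • (z.1 - s.x)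
        α := α'
        net := z.2.communicate 1 }

/-- Distributed accelerated SVRG (DASVRG) for `N = m * n` functions on `m` machines with room for
`nt` samples each, started at `x0`, with step length `η`, `T` iterative updates in each stage,
`K` stages in each outer iteration, `P` outer iterations and sample size `Q = T K P`.
The result is the law of the final variables; the output of the algorithm is the variable `x`. -/
def dasvrg {d m n : ℕ} [NeZero m] [NeZero n] (f : Fin (m * n) → Vec d → ℝ) (nt : ℕ)
    (μ σ η : ℝ) (T K P : ℕ) (x0 : Vec d) : PMF (OuterState d (m * n)) :=
  let q : ℝ := μ / (μ + σ)
  (dataAllocation m n nt (T * K * P)).bind fun D =>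
    loop (fun _ => outerIteration f D.1 q σ η T K) P
      { x := x0, y := x0, α := √q, net := { samples := D.2, active := 0, calls := 0, rounds := 0 } }

/-- The expectation of a nonnegative quantity under a discrete law. -/
def expectation {α : Type} (p : PMF α) (g : α → ℝ≥0∞) : ℝ≥0∞ :=
  ∑' s, p s * g s

end DASVRG

end

/-! The proof separates the randomness from the optimization.

Randomness. Drawing without replacement from the stored multi-sets behaves like drawing fresh
independent uniform indices. The allocation rule makes `r` an i.i.d. uniform sequence
(`uniform_bind_allocation`). Drawing from what is left of a block amounts to exchanging two
positions of `r` and then reading the next one; a uniform sequence is invariant under such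
exchanges, so the index is uniform and the unread samples stay uniform and independent of it
(`uniform_bind_innerUpdate`). The partition `S` is correlated with `r`, but it enters only through
sums over all indices and can be frozen. Hence `dasvrg_eq`: the iterates have the law of SVRG with
fresh indices, while the counts of calls and rounds are deterministic.

Optimization. Write `a = √q`. As `a` is a fixed point of the recursion, `α_p = a` for all `p`. A
single stage halves the expected gap of the proximal objective (`expectation_freshStage_le`), so `K`
stages shrink it by at least `a² / 48`. The accelerated proximal point method has a potential that
contracts by `1 - a / 2` up to `3 / a` times the error of the subproblem (`proxPotential_next_le`),
and the initial gap of the subproblem is at most four times this potential (`prox_gap_le`). Together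
each outer iteration contracts the expected potential by `1 - a / 4`, so about `(4 / a) (1 + log⁺)`
outer iterations suffice. The bounds follow from `1 / a ≤ 1 + √(κ / n)`, `K = O(1 + log (1 + κ /
n))` and `T ≤ 193 n`; the last bounds the changes of machine by `O(K P₀ / c)`. -/

namespace DASVRG

/-! ### Smoothness, strong convexity and their duality. -/

section ConvexAnalysis

open Filter Topology

variable {E : Type*} [NormedAddCommGroup E] [InnerProductSpace ℝ E]

/-- `B` selects a subgradient of `h` at every point. -/
def IsSubgradientMap (h : E → ℝ) (B : E → E) : Prop :=
  ∀ u v, h u + inner ℝ (B u) (v - u) ≤ h v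

/-- The descent lemma. -/
theorem IsSubgradientMap.le_add_sq {h : E → ℝ} {B : E → E} (hB : IsSubgradientMap h B) {L : ℝ}
    (hL : ∀ x y, ‖B x - B y‖ ≤ L * ‖x - y‖) (u v : E) :
    h v ≤ h u + inner ℝ (B u) (v - u) + L / 2 * ‖v - u‖ ^ 2 := by
  set w := v - u with hw
  -- A Riemann sum replaces integration along the segment, since `h` need not be known to be
  -- differentiable: the lemma is later applied to a conjugate function. The subgradient inequality
  -- at the right end of each of `n + 1` pieces bounds the increment, and the Lipschitz errors add
  -- up to a triangular number.
  have step : ∀ (n : ℕ) (k : ℕ), h (u + ((k : ℝ) / (n + 1)) • w) ≤ h u +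
      (k : ℝ) / (n + 1) * inner ℝ (B u) w
        + L * ‖w‖ ^ 2 / (n + 1) ^ 2 * ((k : ℝ) * (k + 1) / 2) := by
    intro n k
    have hn : (0 : ℝ) < n + 1 := by positivity
    induction k with
    | zero => simp
    | succ k ih =>
      have h1 := hB (u + (((k + 1 : ℕ) : ℝ) / (n + 1)) • w) (u + ((k : ℝ) / (n + 1)) • w)
      have e1 : u + ((k : ℝ) / (n + 1)) • w - (u + (((k + 1 : ℕ) : ℝ) / (n + 1)) • w)
          = (-(1 / ((n : ℝ) + 1))) • w := by
        rw [add_sub_add_left_eq_sub, ← sub_smul]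
        congr 1
        push_cast
        field_simp
        ring
      rw [e1, inner_smul_right] at h1
      have h2 : inner ℝ (B (u + (((k + 1 : ℕ) : ℝ) / (n + 1)) • w)) w
          ≤ inner ℝ (B u) w + L * ((k + 1) / (n + 1)) * ‖w‖ ^ 2 := by
        have h3 := real_inner_le_norm (B (u + (((k + 1 : ℕ) : ℝ) / (n + 1)) • w) - B u) w
        have h4 := hL (u + (((k + 1 : ℕ) : ℝ) / (n + 1)) • w) u
        rw [add_sub_cancel_left, norm_smul, Real.norm_of_nonneg (by positivity)] at h4
        rw [inner_sub_left] at h3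
        have h5 := mul_le_mul_of_nonneg_right h4 (norm_nonneg w)
        push_cast at h3 h5 ⊢
        nlinarith
      have h6 := mul_le_mul_of_nonneg_left h2 (by positivity : 0 ≤ 1 / ((n : ℝ) + 1))
      have e2 : 1 / ((n : ℝ) + 1) * (inner ℝ (B u) w + L * ((k + 1) / (n + 1)) * ‖w‖ ^ 2)
          + ((k : ℝ) / (n + 1) * inner ℝ (B u) w
            + L * ‖w‖ ^ 2 / (n + 1) ^ 2 * ((k : ℝ) * (k + 1) / 2))
          = ((k + 1 : ℕ) : ℝ) / (n + 1) * inner ℝ (B u) w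
        + L * ‖w‖ ^ 2 / (n + 1) ^ 2 * (((k + 1 : ℕ) : ℝ) * ((k + 1 : ℕ) + 1) / 2) := by
        push_cast
        field_simp
        ring
      linarith
  have bound : ∀ n : ℕ, h v ≤ h u + inner ℝ (B u) w + L * ‖w‖ ^ 2 / 2
      + L * ‖w‖ ^ 2 / 2 * (1 / ((n : ℝ) + 1)) := by
    intro n
    have hn : (0 : ℝ) < n + 1 := by positivity
    have h1 := step n (n + 1)
    have e1 : ((n + 1 : ℕ) : ℝ) / (n + 1) = 1 := by push_cast; exact div_self hn.ne'
    have e2 : L * ‖w‖ ^ 2 / (n + 1) ^ 2 * (((n + 1 : ℕ) : ℝ) * ((n + 1 : ℕ) + 1) / 2)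
        = L * ‖w‖ ^ 2 / 2 + L * ‖w‖ ^ 2 / 2 * (1 / ((n : ℝ) + 1)) := by
      push_cast
      field_simp
    rw [e1, e2, one_smul, one_mul, hw, add_sub_cancel] at h1
    rw [hw]
    linarith
  have lim : Tendsto (fun n : ℕ => h u + inner ℝ (B u) w + L * ‖w‖ ^ 2 / 2
      + L * ‖w‖ ^ 2 / 2 * (1 / ((n : ℝ) + 1))) atTop
      (𝓝 (h u + inner ℝ (B u) w + L * ‖w‖ ^ 2 / 2 + L * ‖w‖ ^ 2 / 2 * 0)) :=
    tendsto_const_nhds.add (tendsto_const_nhds.mul tendsto_one_div_add_atTop_nhds_zero_nat)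
  have := ge_of_tendsto' lim bound
  linarith

/-- The Baillon–Haddad inequality. -/
theorem IsSubgradientMap.add_norm_sq_le {h : E → ℝ} {B : E → E} (hB : IsSubgradientMap h B) {L : ℝ}
    (hL0 : 0 < L) (hL : ∀ x y, ‖B x - B y‖ ≤ L * ‖x - y‖) (u v : E) :
    h u + inner ℝ (B u) (v - u) + 1 / (2 * L) * ‖B v - B u‖ ^ 2 ≤ h v := by
  -- This point minimizes the quadratic upper model at `v` of `h - ⟨B u, ·⟩`. The lower bound from
  -- `u` and the upper bound from `v` are compared there.
  set w := v - (1 / L) • (B v - B u) with hw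
  have h1 := hB u w
  have h2 := hB.le_add_sq hL v w
  have e1 : w - v = -((1 / L) • (B v - B u)) := by rw [hw]; abel
  have e2 : w - u = (v - u) - (1 / L) • (B v - B u) := by rw [hw]; abel
  rw [e1, norm_neg, norm_smul, Real.norm_of_nonneg (by positivity), inner_neg_right,
    inner_smul_right] at h2
  rw [e2, inner_sub_right, inner_smul_right] at h1
  have e3 : inner ℝ (B v) (B v - B u) - inner ℝ (B u) (B v - B u) = ‖B v - B u‖ ^ 2 := by
    rw [← inner_sub_left, real_inner_self_eq_norm_sq]
  have e4 : L / 2 * (1 / L * ‖B v - B u‖) ^ 2 = 1 / (2 * L) * ‖B v - B u‖ ^ 2 := by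
    field_simp
  have e5 : 1 / L * ‖B v - B u‖ ^ 2 = 2 * (1 / (2 * L) * ‖B v - B u‖ ^ 2) := by
    field_simp
  have e6 : 1 / L * inner ℝ (B v) (B v - B u) - 1 / L * inner ℝ (B u) (B v - B u)
      = 1 / L * ‖B v - B u‖ ^ 2 := by rw [← e3]; ring
  linarith

/-- Strong convexity is dual to smoothness. -/
theorem IsSubgradientMap.add_sq_le {h : E → ℝ} {B : E → E} (hB : IsSubgradientMap h B) {μ : ℝ}
    (hμ : 0 < μ) (hexp : ∀ x y, μ * ‖x - y‖ ≤ ‖B x - B y‖) (hsurj : Function.Surjective B)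
    (x y : E) : h x + inner ℝ (B x) (y - x) + μ / 2 * ‖y - x‖ ^ 2 ≤ h y := by
  obtain ⟨C, hC⟩ := hsurj.hasRightInverse
  have hinj : ∀ x y, B x = B y → x = y := by
    intro x y hxy
    have := hexp x y
    rw [hxy, sub_self, norm_zero] at this
    have h0 : ‖x - y‖ = 0 := le_antisymm (by nlinarith [norm_nonneg (x - y)]) (norm_nonneg _)
    exact sub_eq_zero.1 (norm_eq_zero.1 h0)
  have hCB : ∀ x, C (B x) = x := fun x => hinj _ _ (hC (B x))
  -- The convex conjugate of `h`. The inverse `C` of `B` is a `1 / μ`-Lipschitz subgradient map for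
  -- it, so Baillon–Haddad for `g` at `B y`, `B x` is strong convexity of `h`.
  set g : E → ℝ := fun w => inner ℝ w (C w) - h (C w) with hg
  have hgC : IsSubgradientMap g C := by
    intro u v
    have h1 := hB (C v) (C u)
    simp only [hg]
    rw [hC v] at h1
    rw [inner_sub_right] at h1 ⊢
    rw [real_inner_comm v (C u), real_inner_comm u (C u)]
    linarith
  have hlip : ∀ u v, ‖C u - C v‖ ≤ 1 / μ * ‖u - v‖ := by
    intro u v
    have h1 := hexp (C u) (C v)
    rw [hC u, hC v] at h1
    rw [one_div, inv_mul_eq_div, le_div_iff₀ hμ]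
    linarith
  have key := hgC.add_norm_sq_le (by positivity) hlip (B y) (B x)
  simp only [hg, hCB] at key
  have e1 : 1 / (2 * (1 / μ)) = μ / 2 := by field_simp
  rw [e1, norm_sub_rev x y, inner_sub_right, real_inner_comm (B x) y, real_inner_comm (B y) y]
    at key
  rw [inner_sub_right]
  linarith

theorem exists_isMinOn_add_sq {E : Type*} [NormedAddCommGroup E] [ProperSpace E] {h : E → ℝ} (hc : Continuous h) {b : ℝ}
    (hb : ∀ x, b ≤ h x) {σ : ℝ} (hσ : 0 < σ) (y : E) :
    ∃ z, ∀ x, h z + σ / 2 * ‖z - y‖ ^ 2 ≤ h x + σ / 2 * ‖x - y‖ ^ 2 := by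
  have hcont : Continuous fun x => h x + σ / 2 * ‖x - y‖ ^ 2 := by fun_prop
  refine hcont.exists_forall_le ?_
  have h1 : Tendsto (fun x : E => ‖x - y‖) (cocompact E) atTop := by
    simpa [dist_eq_norm] using tendsto_dist_right_cocompact_atTop y
  have h2 : Tendsto (fun x : E => σ / 2 * ‖x - y‖ ^ 2) (cocompact E) atTop :=
    ((tendsto_pow_atTop (two_ne_zero)).comp h1).const_mul_atTop (by positivity)
  exact tendsto_atTop_add_left_of_le _ b hb h2

variable [CompleteSpace E]

theorem hasGradientAt_add_sq {h : E → ℝ} (hd : Differentiable ℝ h) (σ : ℝ) (y x : E) :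
    HasGradientAt (fun x => h x + σ / 2 * ‖x - y‖ ^ 2) (∇ h x + σ • (x - y)) x := by
  have h1 := (hd x).hasGradientAt.hasFDerivAt
  have h2 : HasFDerivAt (fun x => σ / 2 * ‖x - y‖ ^ 2)
      ((InnerProductSpace.toDual ℝ E) (σ • (x - y))) x := by
    have h3 := (((hasFDerivAt_id x).sub_const y).norm_sq).const_mul (σ / 2)
    refine h3.congr_fderiv ?_
    ext v
    simp
    ring
  rw [hasGradientAt_iff_hasFDerivAt, map_add]
  exact h1.add h2

theorem gradient_eq_zero_of_forall_le {h : E → ℝ} {z : E} (hz : ∀ x, h z ≤ h x) : ∇ h z = 0 := by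
  have : IsLocalMin h z := Filter.Eventually.of_forall hz
  rw [gradient, this.fderiv_eq_zero, map_zero]

theorem isSubgradientMap_gradient {h : E → ℝ} (hconv : ConvexOn ℝ Set.univ h)
    (hd : Differentiable ℝ h) : IsSubgradientMap h (∇ h) := by
  intro u v
  set φ : ℝ → ℝ := fun t => h (u + t • (v - u)) with hφ
  have hφc : ConvexOn ℝ Set.univ φ := by
    have := hconv.comp_affineMap (AffineMap.lineMap u v : ℝ →ᵃ[ℝ] E)
    rw [Set.preimage_univ] at this
    have e : φ = h ∘ (AffineMap.lineMap u v : ℝ →ᵃ[ℝ] E) := by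
      funext t
      simp [hφ, AffineMap.lineMap_apply, add_comm]
    rwa [e]
  have hφd : HasDerivAt φ (inner ℝ (∇ h u) (v - u)) 0 := by
    have h1 := (hd u).hasGradientAt.hasFDerivAt
    have h2 : HasDerivAt (fun t : ℝ => u + t • (v - u)) (v - u) 0 := by
      simpa using ((hasDerivAt_id (0 : ℝ)).smul_const (v - u)).const_add u
    have h3 : HasFDerivAt h ((InnerProductSpace.toDual ℝ E) (∇ h u)) (u + (0 : ℝ) • (v - u)) := by
      simpa using h1
    have h4 := h3.comp_hasDerivAt (0 : ℝ) h2
    rwa [InnerProductSpace.toDual_apply_apply] at h4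
  have := hφc.le_slope_of_hasDerivAt (Set.mem_univ 0) (Set.mem_univ 1) zero_lt_one hφd
  simp only [slope, hφ, sub_zero, inv_one, one_smul, zero_smul, add_zero, add_sub_cancel,
    vsub_eq_sub] at this
  linarith

/-- Expansiveness and continuity make the range closed. It is also dense: minimizing `h + (δ / 2) ‖x
- v / δ‖²` solves `∇ h z + δ z = v`, and expansiveness bounds `z` uniformly in small `δ`, so `∇ h z
→ v` as `δ → 0`. -/
theorem surjective_gradient [ProperSpace E] {h : E → ℝ} (hd : Differentiable ℝ h)
    {L μ b : ℝ} (hL : ∀ x y, ‖∇ h x - ∇ h y‖ ≤ L * ‖x - y‖)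
    (hμ : 0 < μ) (hexp : ∀ x y, μ * ‖x - y‖ ≤ ‖∇ h x - ∇ h y‖) (hb : ∀ x, b ≤ h x) :
    Function.Surjective (∇ h) := by
  have hanti : AntilipschitzWith (Real.toNNReal μ⁻¹) (∇ h) := by
    refine AntilipschitzWith.of_le_mul_dist fun x y => ?_
    rw [Real.coe_toNNReal _ (by positivity), dist_eq_norm, dist_eq_norm, inv_mul_eq_div,
      le_div_iff₀ hμ]
    linarith [hexp x y]
  have hlip : UniformContinuous (∇ h) := by
    refine (LipschitzWith.of_dist_le_mul (K := Real.toNNReal |L|) fun x y => ?_).uniformContinuous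
    rw [Real.coe_toNNReal _ (abs_nonneg L), dist_eq_norm, dist_eq_norm]
    exact (hL x y).trans (mul_le_mul_of_nonneg_right (le_abs_self L) (norm_nonneg _))
  have hclosed := hanti.isClosed_range hlip
  intro v
  suffices hv : v ∈ closure (Set.range (∇ h)) by rwa [hclosed.closure_eq] at hv
  have hex : ∀ δ : ℝ, 0 < δ → ∃ z, ∇ h z + δ • z = v := by
    intro δ hδ
    obtain ⟨z, hz⟩ := exists_isMinOn_add_sq hd.continuous hb hδ (δ⁻¹ • v)
    refine ⟨z, ?_⟩
    have h1 := gradient_eq_zero_of_forall_le (h := fun x => h x + δ / 2 * ‖x - δ⁻¹ • v‖ ^ 2) hz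
    rw [(hasGradientAt_add_sq hd δ _ z).gradient, smul_sub, smul_inv_smul₀ hδ.ne'] at h1
    rw [← sub_eq_zero, ← h1]
    abel
  set C := 2 / μ * ‖v - ∇ h 0‖ with hCdef
  have hbd : ∀ δ : ℝ, 0 < δ → δ ≤ μ / 2 → ∀ z, ∇ h z + δ • z = v → ‖z‖ ≤ C := by
    intro δ hδ hδμ z hz
    have h1 := hexp z 0
    have e1 : ∇ h z - ∇ h 0 = (v - ∇ h 0) - δ • z := by rw [← hz]; abel
    have h2 := norm_sub_le (v - ∇ h 0) (δ • z)
    rw [e1, sub_zero] at h1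
    rw [norm_smul, Real.norm_of_nonneg hδ.le] at h2
    have h3 := mul_le_mul_of_nonneg_right hδμ (norm_nonneg z)
    rw [hCdef, div_mul_eq_mul_div, le_div_iff₀ hμ]
    linarith
  rw [Metric.mem_closure_iff]
  intro ε hε
  have hC : 0 ≤ C := by positivity
  set δ := min (μ / 2) (ε / (2 * (C + 1))) with hδdef
  have hδ : 0 < δ := by positivity
  obtain ⟨z, hz⟩ := hex δ hδ
  refine ⟨∇ h z, ⟨z, rfl⟩, ?_⟩
  have h1 := hbd δ hδ (min_le_left _ _) z hz
  rw [dist_eq_norm, ← hz, add_sub_cancel_left, norm_smul, Real.norm_of_nonneg hδ.le]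
  have h2 : δ ≤ ε / (2 * (C + 1)) := min_le_right _ _
  rw [le_div_iff₀ (by positivity)] at h2
  nlinarith

end ConvexAnalysis

end DASVRG

namespace DASVRG

/-! ### Finite sums of smooth convex functions. -/

section Deterministic

variable {d N : ℕ}

/-- Convex differentiable functions with `L`-Lipschitz gradients. -/
structure SmoothConvexData (f : Fin N → Vec d → ℝ) (L : ℝ) : Prop where
  convexOn : ∀ i, ConvexOn ℝ Set.univ (f i)
  differentiable : ∀ i, Differentiable ℝ (f i)
  lipschitz : ∀ i x y, ‖∇ (f i) x - ∇ (f i) y‖ ≤ L * ‖x - y‖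

theorem objective_proxData [NeZero N] (f : Fin N → Vec d → ℝ) (σ : ℝ) (y x : Vec d) :
    objective (proxData f σ y) x = objective f x + σ / 2 * ‖x - y‖ ^ 2 := by
  have hN : (N : ℝ) ≠ 0 := NeZero.ne _
  simp only [objective, proxData, Finset.sum_add_distrib, Finset.sum_const, Finset.card_univ,
    Fintype.card_fin, nsmul_eq_mul]
  field_simp

namespace SmoothConvexData

variable {f : Fin N → Vec d → ℝ} {L : ℝ}

theorem isSubgradientMap (hf : SmoothConvexData f L) (i : Fin N) :
    IsSubgradientMap (f i) (∇ (f i)) :=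
  isSubgradientMap_gradient (hf.convexOn i) (hf.differentiable i)

theorem hasGradientAt_objective (hf : SmoothConvexData f L) (x : Vec d) :
    HasGradientAt (objective f) ((1 / (N : ℝ)) • ∑ i, ∇ (f i) x) x := by
  rw [hasGradientAt_iff_hasFDerivAt]
  have h1 : HasFDerivAt (fun x => ∑ i, f i x)
      (∑ i, (InnerProductSpace.toDual ℝ (Vec d)) (∇ (f i) x)) x :=
    HasFDerivAt.fun_sum fun i _ => (hf.differentiable i x).hasGradientAt.hasFDerivAt
  rw [map_smul, map_sum]
  exact h1.const_mul (1 / (N : ℝ))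

theorem gradient_objective (hf : SmoothConvexData f L) (x : Vec d) :
    ∇ (objective f) x = (1 / (N : ℝ)) • ∑ i, ∇ (f i) x :=
  (hf.hasGradientAt_objective x).gradient

theorem differentiable_objective (hf : SmoothConvexData f L) :
    Differentiable ℝ (objective f) :=
  fun x => (hf.hasGradientAt_objective x).differentiableAt

theorem convexOn_objective (hf : SmoothConvexData f L) :
    ConvexOn ℝ Set.univ (objective f) := by
  have h1 : ConvexOn ℝ Set.univ (fun x => ∑ i, f i x) := by
    refine ⟨convex_univ, fun x hx y hy a b ha hb hab => ?_⟩
    simp only [Finset.smul_sum, ← Finset.sum_add_distrib]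
    exact Finset.sum_le_sum fun i _ => (hf.convexOn i).2 hx hy ha hb hab
  exact h1.smul (by positivity : 0 ≤ 1 / (N : ℝ))

theorem isSubgradientMap_objective (hf : SmoothConvexData f L) :
    IsSubgradientMap (objective f) (∇ (objective f)) :=
  isSubgradientMap_gradient hf.convexOn_objective hf.differentiable_objective

theorem objective_le (hf : SmoothConvexData f L)
    {z : Vec d} (hz : ∇ (objective f) z = 0) (x : Vec d) : objective f z ≤ objective f x := by
  have := hf.isSubgradientMap_objective z x
  rw [hz, inner_zero_left] at this
  linarith

theorem lipschitz_objective [NeZero N] (hf : SmoothConvexData f L) (x y : Vec d) :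
    ‖∇ (objective f) x - ∇ (objective f) y‖ ≤ L * ‖x - y‖ := by
  have hN : (0 : ℝ) < N := Nat.cast_pos.2 (NeZero.pos N)
  rw [hf.gradient_objective, hf.gradient_objective, ← smul_sub, ← Finset.sum_sub_distrib, norm_smul,
    Real.norm_of_nonneg (by positivity), one_div, inv_mul_le_iff₀ hN]
  calc ‖∑ i, (∇ (f i) x - ∇ (f i) y)‖ ≤ ∑ i, ‖∇ (f i) x - ∇ (f i) y‖ := norm_sum_le _ _
    _ ≤ ∑ _i : Fin N, L * ‖x - y‖ := Finset.sum_le_sum fun i _ => hf.lipschitz i x y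
    _ = N * (L * ‖x - y‖) := by simp

theorem proxData (hf : SmoothConvexData f L) {σ : ℝ} (hσ : 0 ≤ σ) (y : Vec d) :
    SmoothConvexData (proxData f σ y) (L + σ) := by
  have hg : ∀ i x, HasGradientAt (DASVRG.proxData f σ y i) (∇ (f i) x + σ • (x - y)) x :=
    fun i x => hasGradientAt_add_sq (hf.differentiable i) σ y x
  refine ⟨fun i => ?_, fun i x => (hg i x).differentiableAt, fun i x z => ?_⟩
  · have h1 : ConvexOn ℝ Set.univ (fun x : Vec d => ‖x - y‖) := by
      simpa [dist_eq_norm] using convexOn_univ_dist y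
    have h2 := (h1.pow (fun x _ => norm_nonneg _) 2).smul (by positivity : 0 ≤ σ / 2)
    exact (hf.convexOn i).add h2
  · rw [(hg i x).gradient, (hg i z).gradient]
    have e : ∇ (f i) x + σ • (x - y) - (∇ (f i) z + σ • (z - y))
        = (∇ (f i) x - ∇ (f i) z) + σ • (x - z) := by
      rw [smul_sub, smul_sub, smul_sub]; abel
    rw [e, add_mul]
    refine (norm_add_le _ _).trans (add_le_add (hf.lipschitz i x z) ?_)
    rw [norm_smul, Real.norm_of_nonneg hσ]

/-- Strong convexity is given only as expansiveness of the gradient. The minimizer supplies the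
lower bound that makes the gradient surjective, after which conjugation gives the quadratic lower
bound. -/
theorem strongConvexity [NeZero N] (hf : SmoothConvexData f L) {μ : ℝ} (hμ : 0 < μ)
    (hexp : ∀ x y, μ * ‖x - y‖ ≤ ‖∇ (objective f) x - ∇ (objective f) y‖)
    {xstar : Vec d} (hmin : ∀ x, objective f xstar ≤ objective f x) (x y : Vec d) :
    objective f x + inner ℝ (∇ (objective f) x) (y - x) + μ / 2 * ‖y - x‖ ^ 2 ≤ objective f y :=
  hf.isSubgradientMap_objective.add_sq_le hμ hexp
    (surjective_gradient hf.differentiable_objective hf.lipschitz_objective hμ hexp hmin) x y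

end SmoothConvexData

/-! ### One variance-reduced step. -/

section Svrg

variable [NeZero N] {g : Fin N → Vec d → ℝ} {L : ℝ} {z : Vec d}

theorem sum_norm_sub_mean_sq_le (a : Fin N → Vec d) :
    ∑ i, ‖a i - (1 / (N : ℝ)) • ∑ j, a j‖ ^ 2 ≤ ∑ i, ‖a i‖ ^ 2 := by
  have hN : (0 : ℝ) < N := Nat.cast_pos.2 (NeZero.pos N)
  set s := ∑ j, a j with hs
  have h1 : ∑ i, ‖a i - (1 / (N : ℝ)) • s‖ ^ 2 = ∑ i, ‖a i‖ ^ 2 - 1 / N * ‖s‖ ^ 2 := by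
    simp_rw [norm_sub_sq_real, inner_smul_right, Finset.sum_add_distrib, Finset.sum_sub_distrib,
      ← Finset.mul_sum, ← sum_inner, norm_smul, ← hs, real_inner_self_eq_norm_sq]
    simp only [Finset.sum_const, Finset.card_univ, Fintype.card_fin, nsmul_eq_mul,
      Real.norm_of_nonneg (by positivity : 0 ≤ 1 / (N : ℝ))]
    field_simp
    ring
  rw [h1]
  have : 0 ≤ 1 / (N : ℝ) * ‖s‖ ^ 2 := by positivity
  linarith

/-- The Baillon–Haddad inequality averaged over `i`; the linear terms cancel because the gradients
at `z` sum to zero. -/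
theorem SmoothConvexData.sum_norm_gradient_sub_sq_le (hg : SmoothConvexData g L) (hL : 0 < L)
    (hz : ∇ (objective g) z = 0) (x : Vec d) :
    1 / (N : ℝ) * ∑ i, ‖∇ (g i) x - ∇ (g i) z‖ ^ 2 ≤
      2 * L * (objective g x - objective g z) := by
  have hN : (0 : ℝ) < N := Nat.cast_pos.2 (NeZero.pos N)
  have h1 : ∀ i, ‖∇ (g i) x - ∇ (g i) z‖ ^ 2 ≤
      2 * L * (g i x - g i z - inner ℝ (∇ (g i) z) (x - z)) := by
    intro i
    have h2 := (hg.isSubgradientMap i).add_norm_sq_le hL (hg.lipschitz i) z x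
    have h3 : 1 / (2 * L) * ‖∇ (g i) x - ∇ (g i) z‖ ^ 2 ≤
      g i x - g i z - inner ℝ (∇ (g i) z) (x - z) := by linarith
    rwa [one_div, inv_mul_le_iff₀ (by positivity)] at h3
  have h2 := Finset.sum_le_sum fun i (_ : i ∈ Finset.univ) => h1 i
  rw [← Finset.mul_sum, Finset.sum_sub_distrib, Finset.sum_sub_distrib, ← sum_inner] at h2
  have h3 : ∑ i, ∇ (g i) z = 0 := by
    rw [hg.gradient_objective] at hz
    exact (smul_eq_zero.1 hz).resolve_left (by positivity)
  rw [h3, inner_zero_left, sub_zero] at h2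
  have h4 := mul_le_mul_of_nonneg_left h2 (by positivity : 0 ≤ 1 / (N : ℝ))
  simp only [objective]
  linarith

/-- The iterate after one variance-reduced step that draws `i`. -/
noncomputable def svrgStep (g : Fin N → Vec d → ℝ) (xref : Vec d) (η : ℝ) (x : Vec d) (i : Fin N) :
    Vec d :=
  x - η • (∇ (g i) x - ∇ (g i) xref + (1 / (N : ℝ)) • ∑ j, ∇ (g j) xref)

/-- The direction `v i` has mean `∇ (objective g) x`, and its second moment is controlled by the two
optimality gaps, so the noise vanishes as both points approach `z`. -/
theorem SmoothConvexData.mean_norm_svrgStep_sub_sq_le (hg : SmoothConvexData g L) (hL : 0 < L)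
    (hz : ∇ (objective g) z = 0) (xref x : Vec d) {η : ℝ} (hη : 0 ≤ η) :
    1 / (N : ℝ) * ∑ i, ‖svrgStep g xref η x i - z‖ ^ 2 ≤
      ‖x - z‖ ^ 2 - 2 * η * (objective g x - objective g z)
        + 4 * L * η ^ 2 * ((objective g x - objective g z)
          + (objective g xref - objective g z)) := by
  have hN : (0 : ℝ) < N := Nat.cast_pos.2 (NeZero.pos N)
  set h := (1 / (N : ℝ)) • ∑ j, ∇ (g j) xref with hh
  set v : Fin N → Vec d := fun i => ∇ (g i) x - ∇ (g i) xref + h with hv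
  have h3 : ∑ i, ∇ (g i) z = 0 := by
    rw [hg.gradient_objective] at hz
    exact (smul_eq_zero.1 hz).resolve_left (by positivity)
  have hsum : (1 / (N : ℝ)) • ∑ i, v i = ∇ (objective g) x := by
    simp only [hv, Finset.sum_add_distrib, Finset.sum_sub_distrib, Finset.sum_const,
      Finset.card_univ, Fintype.card_fin]
    rw [hg.gradient_objective, ← Nat.cast_smul_eq_nsmul ℝ, hh, smul_smul (N : ℝ),
      mul_one_div_cancel hN.ne', one_smul, sub_add_cancel]
  have hvar : 1 / (N : ℝ) * ∑ i, ‖v i‖ ^ 2 ≤ 4 * L * ((objective g x - objective g z)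
          + (objective g xref - objective g z)) := by
    -- The second bracket is a deviation from the mean, as `h` is the mean of `∇ (g i) xref - ∇ (g
    -- i) z`; its second moment is therefore at most the uncentred one.
    have h1 : ∀ i, ‖v i‖ ^ 2 ≤ 2 * ‖∇ (g i) x - ∇ (g i) z‖ ^ 2
        + 2 * ‖(∇ (g i) xref - ∇ (g i) z) - h‖ ^ 2 := by
      intro i
      have e : v i = (∇ (g i) x - ∇ (g i) z) - ((∇ (g i) xref - ∇ (g i) z) - h) := by
        simp only [hv]; abel
      rw [e]
      have p := parallelogram_law_with_norm ℝ (∇ (g i) x - ∇ (g i) z)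
        ((∇ (g i) xref - ∇ (g i) z) - h)
      nlinarith [sq_nonneg ‖∇ (g i) x - ∇ (g i) z + (∇ (g i) xref - ∇ (g i) z - h)‖]
    have h2 := Finset.sum_le_sum fun i (_ : i ∈ Finset.univ) => h1 i
    rw [Finset.sum_add_distrib, ← Finset.mul_sum, ← Finset.mul_sum] at h2
    have h4 := sum_norm_sub_mean_sq_le fun i => ∇ (g i) xref - ∇ (g i) z
    rw [Finset.sum_sub_distrib, h3, sub_zero, ← hh] at h4
    have h5 := hg.sum_norm_gradient_sub_sq_le hL hz x
    have h6 := hg.sum_norm_gradient_sub_sq_le hL hz xref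
    have h7 : ∑ i, ‖v i‖ ^ 2 ≤ 2 * ∑ i, ‖∇ (g i) x - ∇ (g i) z‖ ^ 2
        + 2 * ∑ i, ‖∇ (g i) xref - ∇ (g i) z‖ ^ 2 := by linarith
    have h8 := mul_le_mul_of_nonneg_left h7 (by positivity : 0 ≤ 1 / (N : ℝ))
    linarith
  have hstep : ∀ i, ‖svrgStep g xref η x i - z‖ ^ 2 =
      ‖x - z‖ ^ 2 - 2 * η * inner ℝ (v i) (x - z) + η ^ 2 * ‖v i‖ ^ 2 := by
    intro i
    have e : svrgStep g xref η x i - z = (x - z) - η • v i := by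
      simp only [svrgStep, hv, hh]; abel
    rw [e, norm_sub_sq_real, inner_smul_right, norm_smul, Real.norm_of_nonneg hη,
      real_inner_comm (v i)]
    ring
  have hmean : 1 / (N : ℝ) * ∑ i, ‖svrgStep g xref η x i - z‖ ^ 2 =
      ‖x - z‖ ^ 2 - 2 * η * inner ℝ (∇ (objective g) x) (x - z)
        + η ^ 2 * (1 / (N : ℝ) * ∑ i, ‖v i‖ ^ 2) := by
    simp_rw [hstep]
    rw [Finset.sum_add_distrib, Finset.sum_sub_distrib, ← Finset.mul_sum, ← Finset.mul_sum,
      ← sum_inner, ← hsum, inner_smul_left]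
    simp only [Finset.sum_const, Finset.card_univ, Fintype.card_fin, nsmul_eq_mul,
      RCLike.conj_to_real]
    field_simp
  rw [hmean]
  have h9 := hg.isSubgradientMap_objective x z
  rw [← neg_sub x z, inner_neg_right] at h9
  have h10 := mul_le_mul_of_nonneg_left hvar (sq_nonneg η)
  nlinarith

/-- The potential function of a single stage. -/
noncomputable def svrgPotential (g : Fin N → Vec d → ℝ) (z : Vec d) (c : ℝ) (t : ℕ)
    (x a : Vec d) : ℝ :=
  ‖x - z‖ ^ 2 - c * (objective g x - objective g z) + c * (t * (objective g a - objective g z))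

theorem SmoothConvexData.objective_sub_le (hg : SmoothConvexData g L)
    (hz : ∇ (objective g) z = 0) (x : Vec d) :
    objective g x - objective g z ≤ L / 2 * ‖x - z‖ ^ 2 := by
  have := hg.isSubgradientMap_objective.le_add_sq hg.lipschitz_objective z x
  rw [hz, inner_zero_left] at this
  linarith

/-- Smoothness bounds the subtracted gap at `x` by `‖x - z‖²` when `c * L ≤ 2`. Thus the potential
is nonnegative and dominates the gap of the average. -/
theorem SmoothConvexData.le_svrgPotential (hg : SmoothConvexData g L)
    (hz : ∇ (objective g) z = 0) {c : ℝ} (hc0 : 0 ≤ c) (hc : c * L ≤ 2) (t : ℕ) (x a : Vec d) :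
    c * (t * (objective g a - objective g z)) ≤ svrgPotential g z c t x a := by
  have h1 := mul_le_mul_of_nonneg_left (hg.objective_sub_le hz x) hc0
  have h2 := mul_le_mul_of_nonneg_right hc (sq_nonneg ‖x - z‖)
  unfold svrgPotential
  linarith

/-- A step gains `c` times the gap at the old iterate, whereas the average collects the new
iterates. The term `-c * (gap at x)` in the potential makes up for this shift of the index: the new
iterate's share of the average cancels it. -/
theorem SmoothConvexData.mean_svrgPotential_le (hg : SmoothConvexData g L) (hL : 0 < L)
    (hz : ∇ (objective g) z = 0) (xref x a : Vec d) {η : ℝ} (hη : 0 ≤ η)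
    (hηL : 2 * L * η ≤ 1) (t : ℕ) :
    1 / (N : ℝ) * ∑ i, svrgPotential g z (2 * η - 4 * L * η ^ 2) (t + 1) (svrgStep g xref η x i)
        ((1 / ((t : ℝ) + 1)) • (svrgStep g xref η x i + (t : ℝ) • a)) ≤
      svrgPotential g z (2 * η - 4 * L * η ^ 2) t x a
        + 4 * L * η ^ 2 * (objective g xref - objective g z) := by
  have hN : (0 : ℝ) < N := Nat.cast_pos.2 (NeZero.pos N)
  set c := 2 * η - 4 * L * η ^ 2 with hc
  have hc0 : 0 ≤ c := by rw [hc]; nlinarith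
  have ht : (0 : ℝ) < (t : ℝ) + 1 := by positivity
  have h1 : ∀ i, svrgPotential g z c (t + 1) (svrgStep g xref η x i)
        ((1 / ((t : ℝ) + 1)) • (svrgStep g xref η x i + (t : ℝ) • a)) ≤
      ‖svrgStep g xref η x i - z‖ ^ 2 + c * (t * (objective g a - objective g z)) := by
    intro i
    set w := svrgStep g xref η x i
    have h2 := hg.convexOn_objective.2 (Set.mem_univ w) (Set.mem_univ a)
      (by positivity : 0 ≤ 1 / ((t : ℝ) + 1)) (by positivity : 0 ≤ (t : ℝ) / ((t : ℝ) + 1))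
      (by field_simp; ring)
    rw [smul_eq_mul, smul_eq_mul] at h2
    have e : (1 / ((t : ℝ) + 1)) • (w + (t : ℝ) • a)
        = (1 / ((t : ℝ) + 1)) • w + ((t : ℝ) / ((t : ℝ) + 1)) • a := by
      rw [smul_add, smul_smul, one_div_mul_eq_div]
    rw [← e] at h2
    have h3 := mul_le_mul_of_nonneg_left h2 ht.le
    have e2 : ((t : ℝ) + 1) * (1 / ((t : ℝ) + 1) * objective g w
        + (t : ℝ) / ((t : ℝ) + 1) * objective g a) = objective g w + t * objective g a := by
      field_simp
    rw [e2] at h3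
    have h4 := mul_le_mul_of_nonneg_left h3 hc0
    unfold svrgPotential
    push_cast
    linarith
  have h2 := Finset.sum_le_sum fun i (_ : i ∈ Finset.univ) => h1 i
  rw [Finset.sum_add_distrib, Finset.sum_const, Finset.card_univ, Fintype.card_fin,
    nsmul_eq_mul] at h2
  have h3 := mul_le_mul_of_nonneg_left h2 (by positivity : 0 ≤ 1 / (N : ℝ))
  rw [mul_add, ← mul_assoc (1 / (N : ℝ)) (N : ℝ), one_div_mul_cancel hN.ne', one_mul] at h3
  have h4 := hg.mean_norm_svrgStep_sub_sq_le hL hz xref x hη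
  refine h3.trans ?_
  unfold svrgPotential
  rw [hc]
  linarith

end Svrg

end Deterministic

end DASVRG

namespace DASVRG

/-! ### The inexact accelerated proximal point method with constant `α = a`. -/

section AcceleratedProximalPoint

variable {E : Type*} [NormedAddCommGroup E] [InnerProductSpace ℝ E]

/-- The potential function of the accelerated proximal point method, where `y` is the proximal
point and `a = √q`. -/
noncomputable def proxPotential (F : E → ℝ) (μ a : ℝ) (xs x y : E) : ℝ :=
  F x - F xs + (1 - a / 2) * (μ / 2) * ‖x + ((1 + a) / a) • (y - x) - xs‖ ^ 2

variable {F : E → ℝ} {B : E → E} {μ σ a : ℝ} {xs : E}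

theorem sub_le_proxPotential (hμ : 0 < μ) (ha1 : a < 1) (x y : E) :
    F x - F xs ≤ proxPotential F μ a xs x y := by
  unfold proxPotential
  have : 0 ≤ (1 - a / 2) * (μ / 2) * ‖x + ((1 + a) / a) • (y - x) - xs‖ ^ 2 :=
    mul_nonneg (mul_nonneg (by linarith) (by linarith)) (sq_nonneg _)
  linarith

theorem sq_norm_le_two_div_mul (hSC : ∀ x y, F x + inner ℝ (B x) (y - x) + μ / 2 * ‖y - x‖ ^ 2 ≤ F y)
    (hB : B xs = 0) (x : E) : μ / 2 * ‖x - xs‖ ^ 2 ≤ F x - F xs := by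
  have := hSC xs x
  rw [hB, inner_zero_left] at this
  linarith

theorem proxPotential_self_le (hSC : ∀ x y, F x + inner ℝ (B x) (y - x) + μ / 2 * ‖y - x‖ ^ 2 ≤ F y)
    (hB : B xs = 0) (hμ : 0 < μ) (ha0 : 0 < a) (x : E) :
    proxPotential F μ a xs x x ≤ 2 * (F x - F xs) := by
  have h1 := sq_norm_le_two_div_mul hSC hB x
  have h2 : 0 ≤ μ / 2 * ‖x - xs‖ ^ 2 := by positivity
  unfold proxPotential
  rw [sub_self, smul_zero, add_zero]
  nlinarith

/-- The proximal objective is `(μ + σ)`-strongly convex and `z` is stationary for it. -/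
theorem add_sq_sub_ge_of_prox
    (hSC : ∀ x y, F x + inner ℝ (B x) (y - x) + μ / 2 * ‖y - x‖ ^ 2 ≤ F y)
    {y z : E} (hz : B z + σ • (z - y) = 0) (w : E) :
    (μ + σ) / 2 * ‖w - z‖ ^ 2 ≤
      (F w + σ / 2 * ‖w - y‖ ^ 2) - (F z + σ / 2 * ‖z - y‖ ^ 2) := by
  have h1 := hSC z w
  rw [eq_neg_of_add_eq_zero_left hz, inner_neg_left, inner_smul_left, RCLike.conj_to_real] at h1
  have h2 : ‖w - y‖ ^ 2 = ‖w - z‖ ^ 2 + 2 * inner ℝ (z - y) (w - z) + ‖z - y‖ ^ 2 := by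
    rw [← sub_add_sub_cancel w z y, norm_add_sq_real, real_inner_comm]
  rw [h2]
  linarith

/-- This is what allows the warm start at `x`: a fixed number of stages then makes the error of the
subproblem a small multiple of the potential. The term `σ / 2 * ‖x - y‖ ^ 2` is controlled because
`y - x` is `a / (1 + a)` times `v - x`. -/
theorem prox_gap_le
    (hSC : ∀ x y, F x + inner ℝ (B x) (y - x) + μ / 2 * ‖y - x‖ ^ 2 ≤ F y)
    (hB : B xs = 0) (hmin : ∀ x, F xs ≤ F x) (hμ : 0 < μ) (ha0 : 0 < a) (ha1 : a < 1)
    (hσ : σ = μ * (1 - a ^ 2) / a ^ 2) (x y z : E) :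
    (F x + σ / 2 * ‖x - y‖ ^ 2) - (F z + σ / 2 * ‖z - y‖ ^ 2) ≤
      4 * proxPotential F μ a xs x y := by
  have hσ0 : 0 ≤ σ := by
    rw [hσ]
    exact div_nonneg (mul_nonneg hμ.le (by nlinarith)) (sq_nonneg a)
  have h1 := hmin z
  have h2 : 0 ≤ σ / 2 * ‖z - y‖ ^ 2 := by positivity
  have h3 := sq_norm_le_two_div_mul hSC hB x
  set v := x + ((1 + a) / a) • (y - x) with hv
  have e1 : x - y = -((a / (1 + a)) • (v - x)) := by
    have : a / (1 + a) * ((1 + a) / a) = 1 := by field_simp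
    rw [hv, add_sub_cancel_left, smul_smul, this, one_smul, neg_sub]
  have h4 : σ / 2 * ‖x - y‖ ^ 2 ≤ μ / 2 * ‖v - x‖ ^ 2 := by
    rw [e1, norm_neg, norm_smul, mul_pow, Real.norm_of_nonneg (by positivity), ← mul_assoc]
    refine mul_le_mul_of_nonneg_right ?_ (sq_nonneg _)
    have e2 : σ / 2 * (a / (1 + a)) ^ 2 = μ / 2 * ((1 - a) / (1 + a)) := by
      rw [hσ]; field_simp; ring
    rw [e2]
    refine mul_le_of_le_one_right (by positivity) ?_
    rw [div_le_one (by linarith)]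
    linarith
  have h5 : ‖v - x‖ ^ 2 ≤ 2 * ‖v - xs‖ ^ 2 + 2 * ‖x - xs‖ ^ 2 := by
    have p := parallelogram_law_with_norm ℝ (v - xs) (x - xs)
    rw [sub_sub_sub_cancel_right] at p
    nlinarith [sq_nonneg ‖v - xs + (x - xs)‖]
  have h6 := mul_le_mul_of_nonneg_left h5 (by positivity : 0 ≤ μ / 2)
  have h7 : 0 ≤ μ * ‖v - xs‖ ^ 2 := by positivity
  have h8 : 0 ≤ (1 - a) * (μ * ‖v - xs‖ ^ 2) := mul_nonneg (by linarith) h7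
  have h9 := hmin x
  unfold proxPotential
  rw [← hv]
  linarith

/-- The proximal inequality is tested at `w = x + a (xs - x)`. An exact subproblem would give the
factor `1 - a`; the weight `1 - a / 2` in the potential leaves room to replace `z` by `x'`, and `1 -
a ≤ (1 - a / 2) ^ 2` restores a contraction. -/
theorem proxPotential_next_le
    (hSC : ∀ x y, F x + inner ℝ (B x) (y - x) + μ / 2 * ‖y - x‖ ^ 2 ≤ F y)
    (hmin : ∀ x, F xs ≤ F x) (hμ : 0 < μ) (ha0 : 0 < a) (ha1 : a < 1)
    (hσ : σ = μ * (1 - a ^ 2) / a ^ 2) {x y z : E} (hz : B z + σ • (z - y) = 0) (x' : E) :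
    proxPotential F μ a xs x' (x' + (a * (1 - a) / (a ^ 2 + a)) • (x' - x)) ≤
      (1 - a / 2) * proxPotential F μ a xs x y
        + 3 / a * ((F x' + σ / 2 * ‖x' - y‖ ^ 2) - (F z + σ / 2 * ‖z - y‖ ^ 2)) := by
  have hσ0 : 0 ≤ σ := by
    rw [hσ]
    exact div_nonneg (mul_nonneg hμ.le (by nlinarith)) (sq_nonneg a)
  set e := (F x' + σ / 2 * ‖x' - y‖ ^ 2) - (F z + σ / 2 * ‖z - y‖ ^ 2) with he
  have hG := add_sq_sub_ge_of_prox hSC hz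
  set w := x + a • (xs - x) with hw
  -- strong convexity of `F` at `w`
  have h1 : F w ≤ a * F xs + (1 - a) * F x - μ / 2 * (a * (1 - a)) * ‖xs - x‖ ^ 2 := by
    have p1 := hSC w xs
    have p2 := hSC w x
    have e1 : xs - w = (1 - a) • (xs - x) := by rw [hw, sub_smul, one_smul]; abel
    have e2 : x - w = (-a) • (xs - x) := by rw [hw, neg_smul]; abel
    rw [e1, inner_smul_right, norm_smul, mul_pow, Real.norm_eq_abs, sq_abs] at p1
    rw [e2, inner_smul_right, norm_smul, mul_pow, Real.norm_eq_abs, sq_abs] at p2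
    have q1 := mul_le_mul_of_nonneg_left p1 ha0.le
    have q2 := mul_le_mul_of_nonneg_left p2 (by linarith : 0 ≤ 1 - a)
    nlinarith
  -- the error of the proximal point
  have h2 := hG w
  have h3 : (μ + σ) / 2 * ‖x' - z‖ ^ 2 ≤ e := hG x'
  have he0 : 0 ≤ e := le_trans (by positivity) h3
  -- Young's inequality with weight `a / 2`; the loss `(2 / a - 1) * ‖x' - z‖ ^ 2` costs at most `(2
  -- / a - 1) * e`.
  have h4 : (1 - a / 2) * ‖w - x'‖ ^ 2 - (2 / a - 1) * ‖x' - z‖ ^ 2 ≤ ‖w - z‖ ^ 2 := by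
    have q := sq_nonneg ‖(a / 2) • (w - x') + (x' - z)‖
    rw [norm_add_sq_real, norm_smul, inner_smul_left, mul_pow, Real.norm_eq_abs, sq_abs,
      RCLike.conj_to_real] at q
    have q' := mul_nonneg (by positivity : 0 ≤ 2 / a) q
    have e1 : 2 / a * ((a / 2) ^ 2 * ‖w - x'‖ ^ 2 + 2 * (a / 2 * inner ℝ (w - x') (x' - z))
        + ‖x' - z‖ ^ 2) = a / 2 * ‖w - x'‖ ^ 2 + 2 * inner ℝ (w - x') (x' - z)
        + 2 / a * ‖x' - z‖ ^ 2 := by field_simp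
    rw [e1] at q'
    rw [← sub_add_sub_cancel w x' z, norm_add_sq_real]
    linarith
  have h5 := mul_le_mul_of_nonneg_left h4 (by positivity : 0 ≤ (μ + σ) / 2)
  have h6 : 0 ≤ 2 / a - 1 := by
    rw [sub_nonneg, le_div_iff₀ ha0]; linarith
  have h7 := mul_le_mul_of_nonneg_left h3 h6
  -- the new auxiliary point
  set v' := x' + ((1 + a) / a) • (x' + (a * (1 - a) / (a ^ 2 + a)) • (x' - x) - x') with hv'
  have ev : w - x' = (-a) • (v' - xs) := by
    have c1 : (1 + a) / a * (a * (1 - a) / (a ^ 2 + a)) = (1 - a) / a := by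
      field_simp
      ring
    have c2 : a * ((1 - a) / a) = 1 - a := by field_simp
    rw [hv', add_sub_cancel_left, smul_smul, c1, hw, neg_smul, smul_sub a (x' + _) xs,
      smul_add a x' _, smul_smul, c2]
    module
  have h8 : (μ + σ) / 2 * ‖w - x'‖ ^ 2 = μ / 2 * ‖v' - xs‖ ^ 2 := by
    -- The choice of `σ` means `(μ + σ) * a ^ 2 = μ`.
    rw [ev, norm_smul, mul_pow, Real.norm_eq_abs, sq_abs, hσ]
    field_simp
    ring
  -- comparison of the quadratic terms
  set v := x + ((1 + a) / a) • (y - x) with hv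
  have h9 : σ / 2 * ‖w - y‖ ^ 2 ≤ μ / 2 * (a * (1 - a)) * ‖xs - x‖ ^ 2
      + (1 - a) * (μ / 2 * ‖v - xs‖ ^ 2) := by
    have e1 : w - y = a • (xs - x) - (y - x) := by rw [hw]; abel
    have e2 : v - xs = ((1 + a) / a) • (y - x) - (xs - x) := by rw [hv]; abel
    rw [e1, e2]
    generalize xs - x = u
    generalize y - x = p
    rw [norm_sub_sq_real, norm_sub_sq_real, norm_smul, norm_smul, mul_pow, mul_pow,
      inner_smul_left, inner_smul_left, Real.norm_eq_abs, sq_abs, Real.norm_eq_abs, sq_abs,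
      RCLike.conj_to_real, RCLike.conj_to_real, real_inner_comm u p]
    generalize inner ℝ u p = I
    have key : μ / 2 * (a * (1 - a)) * ‖u‖ ^ 2
      + (1 - a) * (μ / 2 * (((1 + a) / a) ^ 2 * ‖p‖ ^ 2 - 2 * ((1 + a) / a * I)
        + ‖u‖ ^ 2)) - σ / 2 * (a ^ 2 * ‖u‖ ^ 2 - 2 * (a * I) + ‖p‖ ^ 2)
      = μ / 2 * (1 - a) * ((1 + a) / a) * ‖p‖ ^ 2 := by
      rw [hσ]; field_simp; ring
    have : 0 ≤ μ / 2 * (1 - a) * ((1 + a) / a) * ‖p‖ ^ 2 :=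
      mul_nonneg (mul_nonneg (mul_nonneg (by linarith) (by linarith)) (by positivity))
        (sq_nonneg _)
    linarith
  have h10 : 0 ≤ μ / 2 * ‖v - xs‖ ^ 2 := by positivity
  have h11 : 0 ≤ F x - F xs := by linarith [hmin x]
  have h12 : 2 / a * e ≤ 3 / a * e := by
    gcongr; norm_num
  have h13 : 0 ≤ σ / 2 * ‖x' - y‖ ^ 2 := by positivity
  have h14 : F x' - F xs + (1 - a / 2) * (μ / 2 * ‖v' - xs‖ ^ 2) ≤
      (1 - a) * (F x - F xs) + (1 - a) * (μ / 2 * ‖v - xs‖ ^ 2) + 2 / a * e := by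
    rw [← h8]
    linarith
  have h15 : (1 - a) * (μ / 2 * ‖v - xs‖ ^ 2) ≤
      (1 - a / 2) * ((1 - a / 2) * (μ / 2 * ‖v - xs‖ ^ 2)) := by
    have := mul_le_mul_of_nonneg_right (show 1 - a ≤ (1 - a / 2) * (1 - a / 2) by nlinarith) h10
    rwa [mul_assoc (1 - a / 2)] at this
  have h16 : (1 - a) * (F x - F xs) ≤ (1 - a / 2) * (F x - F xs) :=
    mul_le_mul_of_nonneg_right (by linarith) h11
  unfold proxPotential
  rw [← hv, ← hv']
  linarith

end AcceleratedProximalPoint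

end DASVRG

namespace DASVRG

/-! ### Identities for uniform laws and randomized loops. -/

section UniformLaws

theorem bind_congr_of_mem_support {α β : Type*} {p : PMF α} {f g : α → PMF β}
    (h : ∀ a ∈ p.support, f a = g a) : p.bind f = p.bind g := by
  ext b
  rw [PMF.bind_apply, PMF.bind_apply]
  refine tsum_congr fun a => ?_
  by_cases ha : p a = 0
  · rw [ha, zero_mul, zero_mul]
  · rw [h a ((PMF.mem_support_iff p a).2 ha)]

theorem uniformOfFintype_bind_equiv {α β γ : Type*} [Fintype α] [Nonempty α] [Fintype β]
    [Nonempty β] (e : β ≃ α) (F : α → PMF γ) :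
    (PMF.uniformOfFintype β).bind (fun b => F (e b)) = (PMF.uniformOfFintype α).bind F := by
  ext c
  simp only [PMF.bind_apply, PMF.uniformOfFintype_apply, Fintype.card_congr e]
  exact e.tsum_eq fun a => (Fintype.card α : ℝ≥0∞)⁻¹ * F a c

theorem uniformOfFintype_prod_bind {α β γ : Type*} [Fintype α] [Nonempty α] [Fintype β]
    [Nonempty β] (F : α × β → PMF γ) :
    (PMF.uniformOfFintype (α × β)).bind F = (PMF.uniformOfFintype α).bind fun a =>
      (PMF.uniformOfFintype β).bind fun b => F (a, b) := by
  ext c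
  simp only [PMF.bind_apply, PMF.uniformOfFintype_apply, tsum_fintype, Fintype.card_prod,
    Nat.cast_mul, Fintype.sum_prod_type, Finset.mul_sum, ← mul_assoc]
  rw [ENNReal.mul_inv (by simp) (by simp)]

/-- A coordinate of a uniform function may be resampled. -/
theorem uniformOfFintype_bind_update {ι α γ : Type*} [Fintype ι] [DecidableEq ι] [Fintype α]
    [Nonempty α] (t : ι) (G : (ι → α) → PMF γ) :
    (PMF.uniformOfFintype (ι → α)).bind G = (PMF.uniformOfFintype α).bind fun i =>
      (PMF.uniformOfFintype (ι → α)).bind fun r => G (Function.update r t i) := by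
  have hinv : Function.Involutive
      fun p : α × (ι → α) => (p.2 t, Function.update p.2 t p.1) := by
    rintro ⟨i, r⟩
    simp
  have h := uniformOfFintype_bind_equiv hinv.toPerm
    (fun p : α × (ι → α) => G (Function.update p.2 t p.1))
  rw [uniformOfFintype_prod_bind, uniformOfFintype_prod_bind] at h
  rw [← h]
  simp [Function.Involutive.coe_toPerm, PMF.bind_const]

theorem ofMultiset_map_bind {ι α γ : Type*} [DecidableEq α] (s : Finset ι) (hs : s.Nonempty)
    (r : ι → α) (h : s.val.map r ≠ 0) (F : α → PMF γ) :
    (PMF.ofMultiset (s.val.map r) h).bind F = (PMF.uniformOfFinset s hs).bind fun i => F (r i) := by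
  classical
  have e : PMF.ofMultiset (s.val.map r) h
      = (PMF.uniformOfFinset s hs).bind fun i => PMF.pure (r i) := by
    ext a
    rw [PMF.ofMultiset_apply, PMF.bind_apply, tsum_eq_sum (s := s)
      (fun b hb => by rw [PMF.uniformOfFinset_apply_of_notMem hs hb, zero_mul])]
    have h1 : ∀ i ∈ s, PMF.uniformOfFinset s hs i * (PMF.pure (r i)) a
        = (s.card : ℝ≥0∞)⁻¹ * if a = r i then 1 else 0 := by
      intro i hi
      rw [PMF.uniformOfFinset_apply_of_mem hs hi, PMF.pure_apply]
      congr
    rw [Finset.sum_congr rfl h1, ← Finset.mul_sum, Finset.sum_boole, Multiset.count_map,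
      Multiset.card_map, mul_comm, ENNReal.div_eq_inv_mul, mul_comm]
    congr!
    rw [Finset.card_def, Finset.filter_val]
    congr!
  rw [e, PMF.bind_bind]
  simp only [PMF.pure_bind]

/-- `E n` is a random encoding of an abstract state as a concrete one. If encoding intertwines the
two bodies at each step, it intertwines the loops. Below, the encoding adds a network with uniform
unread samples. -/
theorem loop_simulation {α β : Type} {body : ℕ → α → PMF α} {body' : ℕ → β → PMF β}
    (E : ℕ → β → PMF α) (M : ℕ)
    (h : ∀ n < M, ∀ b, (E n b).bind (body n) = (body' n b).bind (E (n + 1))) (b : β) :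
    ∀ n ≤ M, (E 0 b).bind (loop body n) = (loop body' n b).bind (E n) := by
  intro n
  induction n with
  | zero => intro _; simp [loop]
  | succ n ih =>
    intro hn
    simp only [loop]
    rw [← PMF.bind_bind, ih (Nat.le_of_succ_le hn), PMF.bind_bind, PMF.bind_bind]
    exact congrArg _ (funext fun b => h n hn b)

end UniformLaws

/-! ### Bookkeeping of the remaining samples and the active machine. -/

section Sampling

variable {N : ℕ}

/-- The multi-sets of samples that are left after `t` draws in the order of the sequence `r`. -/
def remaining (nt : ℕ) {Q : ℕ} (r : Fin Q → Fin N) (t j : ℕ) : Multiset (Fin N) :=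
  (Finset.univ.filter fun ℓ : Fin Q => ℓ.val / nt = j ∧ t ≤ ℓ.val).val.map r

/-- The active machine after `t` of `Q` draws. -/
def activeAt (nt Q t : ℕ) : ℕ := if t < Q then t / nt else (Q + nt - 1) / nt

/-- The network after `t` of `Q` draws, `c` calls, and `rd` rounds of communication other than the
changes of the active machine. -/
def netAt (nt : ℕ) {Q : ℕ} (t c rd : ℕ) (r : Fin Q → Fin N) : Network N :=
  { samples := remaining nt r t, active := activeAt nt Q t, calls := c,
    rounds := rd + activeAt nt Q t }

theorem netAt_communicate (nt : ℕ) {Q : ℕ} (t c rd k : ℕ) (r : Fin Q → Fin N) :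
    (netAt nt t c rd r).communicate k = netAt nt t c (rd + k) r := by
  simp only [netAt, Network.communicate, Network.mk.injEq, true_and]
  omega

theorem remaining_update (nt : ℕ) {Q : ℕ} (r : Fin Q → Fin N) (t : Fin Q) (i : Fin N) :
    remaining nt (Function.update r t i) (t + 1) = remaining nt r (t + 1) := by
  funext j
  refine Multiset.map_congr rfl fun ℓ hℓ => ?_
  rw [Finset.mem_val, Finset.mem_filter] at hℓ
  refine Function.update_of_ne ?_ _ _
  rintro rfl
  omega

theorem filter_block_eq_cons (nt : ℕ) {Q : ℕ} (t : Fin Q) :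
    (Finset.univ.filter fun ℓ : Fin Q => ℓ.val / nt = t / nt ∧ t.val ≤ ℓ.val).val
      = t ::ₘ (Finset.univ.filter fun ℓ : Fin Q => ℓ.val / nt = t / nt ∧ t.val + 1 ≤ ℓ.val).val := by
  rw [← Finset.insert_val_of_notMem (by simp)]
  congr 1
  ext ℓ
  simp only [Finset.mem_filter, Finset.mem_univ, true_and, Finset.mem_insert, Fin.ext_iff]
  constructor
  · rintro ⟨h1, h2⟩
    by_cases h : ℓ.val = t.val
    · exact Or.inl h
    · exact Or.inr ⟨h1, by omega⟩
  · rintro (h | ⟨h1, h2⟩)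
    · rw [h]; exact ⟨rfl, le_rfl⟩
    · exact ⟨h1, by omega⟩

/-- Removing the sample at position `ℓ` of the active block amounts to exchanging the positions
`t` and `ℓ` and then removing the sample at position `t`. -/
theorem remaining_erase (nt : ℕ) {Q : ℕ} (r : Fin Q → Fin N) (t ℓ : Fin Q)
    (hℓ : ℓ.val / nt = t / nt ∧ t.val ≤ ℓ.val) :
    (remaining nt r t (t / nt)).erase (r ℓ)
        = remaining nt (r ∘ Equiv.swap t ℓ) (t + 1) (t / nt) ∧
      Function.update (remaining nt r t) (t / nt) ((remaining nt r t (t / nt)).erase (r ℓ))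
        = remaining nt (r ∘ Equiv.swap t ℓ) (t + 1) := by
  set s := Finset.univ.filter fun ℓ : Fin Q => ℓ.val / nt = t / nt ∧ t.val ≤ ℓ.val with hs
  have hmem : ∀ k, k ∈ s ↔ k.val / nt = t / nt ∧ t.val ≤ k.val := fun k => by simp [hs]
  have h1 : s.map (Equiv.swap t ℓ).toEmbedding = s := by
    refine Finset.map_perm fun k hk => ?_
    rw [Finset.mem_coe, hmem]
    by_contra hk'
    refine hk (Equiv.swap_apply_of_ne_of_ne ?_ ?_)
    · rintro rfl; exact hk' ⟨rfl, le_rfl⟩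
    · rintro rfl; exact hk' hℓ
  have h2 : s.val.map (r ∘ Equiv.swap t ℓ) = s.val.map r := by
    conv_rhs => rw [← h1]
    rw [Finset.map_val, Multiset.map_map]
    rfl
  have h3 : remaining nt r t (t / nt)
      = r ℓ ::ₘ remaining nt (r ∘ Equiv.swap t ℓ) (t + 1) (t / nt) := by
    have h4 := h2.symm
    conv_rhs at h4 => rw [hs, filter_block_eq_cons nt t, Multiset.map_cons, Function.comp_apply,
      Equiv.swap_apply_left]
    exact h4
  have h4 : (remaining nt r t (t / nt)).erase (r ℓ)
      = remaining nt (r ∘ Equiv.swap t ℓ) (t + 1) (t / nt) := by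
    rw [h3, Multiset.erase_cons_head]
  refine ⟨h4, ?_⟩
  funext j
  rw [Function.update_apply]
  split_ifs with hj
  · rw [h4, hj]
  · have h5 : (Finset.univ.filter fun k : Fin Q => k.val / nt = j ∧ t.val ≤ k.val)
        = Finset.univ.filter fun k : Fin Q => k.val / nt = j ∧ t.val + 1 ≤ k.val := by
      refine Finset.filter_congr fun k _ => ⟨fun ⟨a, b⟩ => ⟨a, ?_⟩, fun ⟨a, b⟩ => ⟨a, by omega⟩⟩
      refine lt_of_le_of_ne b fun h => hj ?_
      rw [h, a]
    unfold remaining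
    rw [h5]
    refine Multiset.map_congr rfl fun k hk => ?_
    rw [Finset.mem_val, Finset.mem_filter] at hk
    rw [Function.comp_apply, Equiv.swap_apply_of_ne_of_ne]
    · rintro rfl; exact hj hk.2.1.symm
    · rintro rfl; exact hj (hk.2.1.symm.trans hℓ.1)

/-- The current block is exhausted exactly when the next position lies in another block or the
sequence ends; the latter covers a short last block, whence the rounded-up quotient in `activeAt`.
-/
theorem activeAt_succ {nt : ℕ} (hnt : 0 < nt) {Q : ℕ} (r : Fin Q → Fin N) (t : Fin Q) :
    activeAt nt Q (t + 1) = activeAt nt Q t + if remaining nt r (t + 1) (t / nt) = 0 then 1 else 0 := by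
  have ht := t.isLt
  have h0 : remaining nt r (t + 1) (t / nt) = 0 ↔
      ¬ (t.val + 1 < Q ∧ (t.val + 1) / nt = t / nt) := by
    rw [remaining, Multiset.map_eq_zero, Finset.val_eq_zero, Finset.filter_eq_empty_iff]
    constructor
    · rintro h ⟨h1, h2⟩
      exact h (x := ⟨t + 1, h1⟩) (Finset.mem_univ _) ⟨h2, le_rfl⟩
    · rintro h ℓ - ⟨h1, h2⟩
      refine h ⟨lt_of_le_of_lt h2 ℓ.isLt, le_antisymm ?_ (Nat.div_le_div_right (Nat.le_succ _))⟩
      rw [← h1]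
      exact Nat.div_le_div_right h2
  have hsucc : (t.val + 1) / nt = t / nt ∨ (t.val + 1) / nt = t / nt + 1 := by
    rw [Nat.succ_div]
    split_ifs <;> simp
  unfold activeAt
  rw [if_pos ht]
  by_cases h1 : t.val + 1 < Q
  · rw [if_pos h1]
    rcases hsucc with h2 | h2
    · rw [if_neg (by rw [h0]; exact not_not.2 ⟨h1, h2⟩), h2, add_zero]
    · rw [if_pos (by rw [h0, h2]; omega), h2]
  · have hQ : Q + nt - 1 = t + nt := by omega
    rw [if_neg h1, if_pos (by rw [h0]; tauto), hQ, Nat.add_div_right _ hnt]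

end Sampling

/-! ### Sampling without replacement has the law of fresh uniform sampling. -/

section FreshSamples

variable {d N : ℕ} [NeZero N]

/-- One iterative update with a fresh uniform index. -/
noncomputable def freshUpdate (g : Fin N → Vec d → ℝ) (xref : Vec d) (η : ℝ) (t : ℕ)
    (s : Vec d × Vec d) : PMF (Vec d × Vec d) :=
  (PMF.uniformOfFintype (Fin N)).bind fun i =>
    PMF.pure (svrgStep g xref η s.1 i,
      (1 / ((t : ℝ) + 1)) • (svrgStep g xref η s.1 i + (t : ℝ) • s.2))

/-- A single stage with fresh uniform indices. -/
noncomputable def freshStage (g : Fin N → Vec d → ℝ) (η : ℝ) (T : ℕ) (x : Vec d) : PMF (Vec d) :=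
  (loop (freshUpdate g x η) T (x, 0)).bind fun s => PMF.pure s.2

/-- An outer iteration with fresh uniform indices and `α = a`. -/
noncomputable def freshOuter (f : Fin N → Vec d → ℝ) (a σ η : ℝ) (T K : ℕ) (s : Vec d × Vec d) :
    PMF (Vec d × Vec d) :=
  (loop (fun _ => freshStage (proxData f σ s.2) η T) K s.1).bind fun z =>
    PMF.pure (z, z + (a * (1 - a) / (a ^ 2 + a)) • (z - s.1))

/-- Exchangeability: choosing position `ℓ` of the rest of the block is the same as swapping `t` and
`ℓ` and reading position `t`, and the swap preserves the uniform law of `r`. -/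
theorem uniform_bind_innerUpdate {nt : ℕ} (hnt : 0 < nt) {Q : ℕ} (g : Fin N → Vec d → ℝ)
    (xref : Vec d) (η : ℝ) (k c rd : ℕ) (t : Fin Q) (s : Vec d × Vec d) :
    ((PMF.uniformOfFintype (Fin Q → Fin N)).bind fun r =>
      innerUpdate g xref ((1 / (N : ℝ)) • ∑ j, ∇ (g j) xref) η k ⟨s.1, s.2, netAt nt t c rd r⟩) =
    (freshUpdate g xref η k s).bind fun s' =>
      (PMF.uniformOfFintype (Fin Q → Fin N)).bind fun r =>
        PMF.pure ⟨s'.1, s'.2, netAt nt (t + 1) c rd r⟩ := by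
  set A := Finset.univ.filter fun ℓ : Fin Q => ℓ.val / nt = t / nt ∧ t.val ≤ ℓ.val with hA
  have hAne : A.Nonempty := ⟨t, by simp [hA]⟩
  have hact : activeAt nt Q t = t / nt := if_pos t.isLt
  let G : Fin N → (Fin Q → Fin N) → PMF (InnerState d N) := fun i r =>
    PMF.pure ⟨svrgStep g xref η s.1 i,
      (1 / ((k : ℝ) + 1)) • (svrgStep g xref η s.1 i + (k : ℝ) • s.2), netAt nt (t + 1) c rd r⟩
  have h1 : ∀ r : Fin Q → Fin N,
      innerUpdate g xref ((1 / (N : ℝ)) • ∑ j, ∇ (g j) xref) η k ⟨s.1, s.2, netAt nt t c rd r⟩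
      = (PMF.uniformOfFinset A hAne).bind fun ℓ =>
          G ((r ∘ Equiv.swap t ℓ) t) (r ∘ Equiv.swap t ℓ) := by
    intro r
    have hsam : (netAt nt t c rd r).samples (netAt nt t c rd r).active = A.val.map r := by
      simp only [netAt, hact, remaining, hA]
    have hne : A.val.map r ≠ 0 := by
      rw [Ne, Multiset.map_eq_zero, Finset.val_eq_zero]
      exact hAne.ne_empty
    unfold innerUpdate
    rw [dif_neg (by rw [hsam]; exact hne)]
    simp only [hsam]
    rw [ofMultiset_map_bind A hAne r hne]
    refine bind_congr_of_mem_support fun ℓ hℓ => ?_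
    rw [PMF.support_uniformOfFinset, Finset.mem_coe, hA, Finset.mem_filter] at hℓ
    obtain ⟨e1, e2⟩ := remaining_erase nt r t ℓ hℓ.2
    have e0 : A.val.map r = remaining nt r t (t / nt) := rfl
    have e3 := activeAt_succ hnt (r ∘ Equiv.swap t ℓ) t
    rw [e0, e1]
    rw [e1] at e2
    simp only [netAt, hact, G, Function.comp_apply, Equiv.swap_apply_left, e2] at e3 ⊢
    congr 1
    split_ifs at e3 ⊢ with h
    · simp only [e3, svrgStep]
      rfl
    · simp only [e3, svrgStep]
      rfl
  simp_rw [h1]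
  rw [PMF.bind_comm]
  have h2 : ∀ ℓ : Fin Q, ((PMF.uniformOfFintype (Fin Q → Fin N)).bind fun r =>
      G ((r ∘ Equiv.swap t ℓ) t) (r ∘ Equiv.swap t ℓ)) =
      (PMF.uniformOfFintype (Fin Q → Fin N)).bind fun r => G (r t) r := fun ℓ =>
    uniformOfFintype_bind_equiv (Equiv.arrowCongr (Equiv.swap t ℓ) (Equiv.refl (Fin N)))
      fun r => G (r t) r
  simp_rw [h2]
  -- The choice of `ℓ` has dropped out. Resampling coordinate `t` yields the fresh index, and the
  -- network after draw `t` no longer depends on that coordinate.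
  rw [PMF.bind_const, uniformOfFintype_bind_update t, freshUpdate, PMF.bind_bind]
  refine congrArg _ (funext fun i => ?_)
  rw [PMF.pure_bind]
  refine congrArg _ (funext fun r => ?_)
  simp only [G, Function.update_self, netAt, remaining_update]

theorem uniform_bind_stage {nt : ℕ} (hnt : 0 < nt) {Q m : ℕ} (g : Fin N → Vec d → ℝ)
    (S : Fin m → Finset (Fin N)) (hS : ∀ φ : Fin N → Vec d, ∑ j, ∑ i ∈ S j, φ i = ∑ i, φ i)
    (η : ℝ) (T t c rd : ℕ) (hQ : t + T ≤ Q) (x : Vec d) :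
    ((PMF.uniformOfFintype (Fin Q → Fin N)).bind fun r =>
      stage g S η T (x, netAt nt t c rd r)) =
    (freshStage g η T x).bind fun x' =>
      (PMF.uniformOfFintype (Fin Q → Fin N)).bind fun r =>
        PMF.pure (x', netAt nt (t + T) (c + 1) (rd + 3) r) := by
  have h := loop_simulation
    (body := innerUpdate g x ((1 / (N : ℝ)) • ∑ j, ∇ (g j) x) η)
    (body' := freshUpdate g x η)
    (fun k s => (PMF.uniformOfFintype (Fin Q → Fin N)).bind fun r =>
      PMF.pure (⟨s.1, s.2, netAt nt (t + k) c (rd + 3) r⟩ : InnerState d N)) T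
    (fun k hk s => by
      rw [PMF.bind_bind]
      simp only [PMF.pure_bind]
      exact uniform_bind_innerUpdate hnt g x η k c (rd + 3) ⟨t + k, by omega⟩ s) (x, 0) T le_rfl
  rw [PMF.bind_bind] at h
  simp only [PMF.pure_bind, add_zero] at h
  simp only [stage, ssSVRG, hS, netAt_communicate]
  rw [← PMF.bind_bind, h, freshStage, PMF.bind_bind, PMF.bind_bind]
  refine congrArg _ (funext fun s => ?_)
  rw [PMF.bind_bind, PMF.pure_bind]
  simp only [PMF.pure_bind]
  rfl

theorem nextAlpha_sqrt {q : ℝ} (hq0 : 0 < q) (hq1 : q < 1) : nextAlpha q √q = √q := by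
  have h0 : 0 < √q := Real.sqrt_pos.2 hq0
  refine ((eq_nextAlpha_iff hq1 h0 _).1 ⟨⟨h0, ?_⟩, ?_⟩).symm
  · rw [← Real.sqrt_one]; exact Real.sqrt_lt_sqrt hq0.le hq1
  · rw [Real.sq_sqrt hq0.le]; ring

theorem uniform_bind_outerIteration {nt : ℕ} (hnt : 0 < nt) {Q m : ℕ} (f : Fin N → Vec d → ℝ)
    (S : Fin m → Finset (Fin N)) (hS : ∀ φ : Fin N → Vec d, ∑ j, ∑ i ∈ S j, φ i = ∑ i, φ i)
    {q : ℝ} (hq0 : 0 < q) (hq1 : q < 1) (σ η : ℝ) (T K t c rd : ℕ) (hQ : t + T * K ≤ Q)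
    (s : Vec d × Vec d) :
    ((PMF.uniformOfFintype (Fin Q → Fin N)).bind fun r =>
      outerIteration f S q σ η T K ⟨s.1, s.2, √q, netAt nt t c rd r⟩) =
    (freshOuter f √q σ η T K s).bind fun s' =>
      (PMF.uniformOfFintype (Fin Q → Fin N)).bind fun r =>
        PMF.pure ⟨s'.1, s'.2, √q, netAt nt (t + T * K) (c + K) (rd + (3 * K + 2)) r⟩ := by
  have h := loop_simulation
    (body := fun _ => stage (proxData f σ s.2) S η T)
    (body' := fun _ => freshStage (proxData f σ s.2) η T)
    (fun k x => (PMF.uniformOfFintype (Fin Q → Fin N)).bind fun r =>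
      PMF.pure (x, netAt nt (t + T * k) (c + k) (rd + 1 + 3 * k) r)) K
    (fun k hk x => by
      rw [PMF.bind_bind]
      simp only [PMF.pure_bind]
      rw [uniform_bind_stage hnt _ S hS]
      · simp only [mul_add, mul_one, ← add_assoc]
      · have := Nat.mul_le_mul_left T (Nat.succ_le_of_lt hk)
        rw [Nat.succ_eq_add_one, mul_add, mul_one] at this
        omega) s.1 K le_rfl
  rw [PMF.bind_bind] at h
  simp only [PMF.pure_bind, mul_zero, add_zero] at h
  simp only [outerIteration, netAt_communicate, nextAlpha_sqrt hq0 hq1]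
  rw [← PMF.bind_bind, h, freshOuter, PMF.bind_bind, PMF.bind_bind]
  refine congrArg _ (funext fun x => ?_)
  rw [PMF.bind_bind, PMF.pure_bind]
  simp only [PMF.pure_bind, netAt_communicate]
  have e : rd + 1 + 3 * K + 1 = rd + (3 * K + 2) := by omega
  rw [e]

end FreshSamples

/-! ### Law of the allocated samples and of the whole algorithm. -/

section Allocation

/-- The samples of the data allocation have the law of independent uniform indices. -/
theorem uniform_bind_allocation {N Q : ℕ} [NeZero N] {γ : Type*} (G : (Fin Q → Fin N) → PMF γ) :
    ((PMF.uniformOfFintype (Equiv.Perm (Fin N))).bind fun π =>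
      (PMF.uniformOfFintype (Fin Q → Fin N)).bind fun u =>
        G fun ℓ => π ⟨min ℓ.val (u ℓ).val, lt_of_le_of_lt (min_le_right _ _) (u ℓ).isLt⟩) =
    (PMF.uniformOfFintype (Fin Q → Fin N)).bind G := by
  -- A hybrid argument: `R k` follows the allocation rule before position `k` and is plainly uniform
  -- from there on, and the law does not depend on `k`.
  let R : ℕ → Equiv.Perm (Fin N) → (Fin Q → Fin N) → Fin Q → Fin N := fun k π u ℓ =>
    if ℓ.val < k then π ⟨min ℓ.val (u ℓ).val, lt_of_le_of_lt (min_le_right _ _) (u ℓ).isLt⟩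
    else u ℓ
  have hstep : ∀ k < Q, ((PMF.uniformOfFintype (Equiv.Perm (Fin N))).bind fun π =>
      (PMF.uniformOfFintype (Fin Q → Fin N)).bind fun u => G (R (k + 1) π u)) =
      (PMF.uniformOfFintype (Equiv.Perm (Fin N))).bind fun π =>
      (PMF.uniformOfFintype (Fin Q → Fin N)).bind fun u => G (R k π u) := by
    intro k hk
    let R' : Equiv.Perm (Fin N) → (Fin Q → Fin N) → Fin Q → Fin N := fun π u ℓ =>
      if ℓ.val < k then π ⟨min ℓ.val (u ℓ).val, lt_of_le_of_lt (min_le_right _ _) (u ℓ).isLt⟩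
      else if ℓ.val = k then π (u ℓ) else u ℓ
    have h1 : ((PMF.uniformOfFintype (Equiv.Perm (Fin N))).bind fun π =>
      (PMF.uniformOfFintype (Fin Q → Fin N)).bind fun u => G (R (k + 1) π u)) =
      (PMF.uniformOfFintype (Equiv.Perm (Fin N))).bind fun π =>
      (PMF.uniformOfFintype (Fin Q → Fin N)).bind fun u => G (R' π u) := by
      rw [PMF.bind_comm, PMF.bind_comm (PMF.uniformOfFintype (Equiv.Perm (Fin N)))]
      refine congrArg _ (funext fun u => ?_)
      -- Composing `π` with this swap turns `π a` into `π (u k)`. The swap is trivial if `u k ≤ k`;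
      -- otherwise it moves only points `≥ k`, which earlier positions never read.
      let a : Fin N := ⟨min k (u ⟨k, hk⟩).val, lt_of_le_of_lt (min_le_right _ _) (u _).isLt⟩
      rw [← uniformOfFintype_bind_equiv (Equiv.mulRight (Equiv.swap a (u ⟨k, hk⟩)))]
      refine congrArg _ (funext fun π => congrArg G (funext fun ℓ => ?_))
      simp only [R, R', Equiv.coe_mulRight, Equiv.Perm.mul_apply]
      by_cases h2 : ℓ.val < k
      · rw [if_pos (by omega), if_pos h2]
        by_cases h3 : (u ⟨k, hk⟩).val ≤ k
        · have : a = u ⟨k, hk⟩ := Fin.ext (min_eq_right h3)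
          rw [this, Equiv.swap_self, Equiv.refl_apply]
        · rw [Equiv.swap_apply_of_ne_of_ne]
          · rw [Ne, Fin.ext_iff]; simp only [a]; omega
          · rw [Ne, Fin.ext_iff]; simp only; omega
      · by_cases h3 : ℓ.val = k
        · have h4 : ℓ = ⟨k, hk⟩ := Fin.ext h3
          subst h4
          rw [if_pos (by omega), if_neg h2, if_pos rfl]
          congr 1
          exact Equiv.swap_apply_left a _
        · rw [if_neg (by omega), if_neg h2, if_neg h3]
    rw [h1]
    refine congrArg _ (funext fun π => ?_)
    -- With `π` fixed, applying `π` to coordinate `k` alone preserves the uniform law of `u`.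
    rw [← uniformOfFintype_bind_equiv
      (Equiv.piCongrRight fun ℓ : Fin Q => if ℓ.val = k then π else Equiv.refl (Fin N))
      fun u => G (R k π u)]
    refine congrArg _ (funext fun u => congrArg G (funext fun ℓ => ?_))
    simp only [R, R', Equiv.piCongrRight_apply, Pi.map_apply]
    by_cases h2 : ℓ.val < k
    · have h3 : ℓ.val ≠ k := h2.ne
      simp [h2, h3]
    · by_cases h3 : ℓ.val = k
      · simp [h3]
      · simp [h2, h3]
  have hall : ∀ k ≤ Q, ((PMF.uniformOfFintype (Equiv.Perm (Fin N))).bind fun π =>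
      (PMF.uniformOfFintype (Fin Q → Fin N)).bind fun u => G (R k π u)) =
      (PMF.uniformOfFintype (Fin Q → Fin N)).bind G := by
    intro k
    induction k with
    | zero =>
      intro _
      simp only [R, Nat.not_lt_zero, if_false]
      exact PMF.bind_const _ _
    | succ k ih => intro hk; rw [hstep k hk, ih (Nat.le_of_succ_le hk)]
  have := hall Q le_rfl
  simpa only [R, Fin.is_lt, if_true] using this

theorem sum_sum_block {d m n : ℕ} [NeZero n] (π : Equiv.Perm (Fin (m * n)))
    (φ : Fin (m * n) → Vec d) :
    ∑ j : Fin m, ∑ i ∈ (Finset.univ.filter fun a : Fin (m * n) => a.val / n = j.val).image π, φ i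
      = ∑ i, φ i := by
  have h1 : ∀ j : Fin m,
      ∑ i ∈ (Finset.univ.filter fun a : Fin (m * n) => a.val / n = j.val).image π, φ i
      = ∑ a with (⟨a.val / n, Nat.div_lt_of_lt_mul (a.isLt.trans_eq (mul_comm m n))⟩ : Fin m) = j,
          φ (π a) := by
    intro j
    rw [Finset.sum_image fun _ _ _ _ h => π.injective h]
    simp only [Fin.ext_iff]
  simp_rw [h1]
  rw [Finset.sum_fiberwise, Equiv.sum_comp]

/-- This decouples the random partition from the samples, both of which are built from the same
permutation. -/
theorem outerIteration_congr {d N m : ℕ} (f : Fin N → Vec d → ℝ) {S S' : Fin m → Finset (Fin N)}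
    (h : ∀ φ : Fin N → Vec d, ∑ j, ∑ i ∈ S j, φ i = ∑ j, ∑ i ∈ S' j, φ i) (q σ η : ℝ) (T K : ℕ) :
    outerIteration f S q σ η T K = outerIteration f S' q σ η T K := by
  funext s
  have : stage (proxData f σ s.y) S η T = stage (proxData f σ s.y) S' η T := by
    funext w
    simp only [stage, h]
  rw [outerIteration, outerIteration, this]

/-- The law of the final variables of DASVRG. -/
theorem dasvrg_eq {d m n : ℕ} [NeZero m] [NeZero n] (f : Fin (m * n) → Vec d → ℝ) {nt : ℕ}
    (hnt : 0 < nt) {μ σ : ℝ} (hq0 : 0 < μ / (μ + σ)) (hq1 : μ / (μ + σ) < 1) (η : ℝ)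
    (T K P : ℕ) (x0 : Vec d) :
    dasvrg f nt μ σ η T K P x0 =
      (loop (fun _ => freshOuter f √(μ / (μ + σ)) σ η T K) P (x0, x0)).bind fun s =>
        (PMF.uniformOfFintype (Fin (T * K * P) → Fin (m * n))).bind fun r =>
          PMF.pure ⟨s.1, s.2, √(μ / (μ + σ)), netAt nt (T * K * P) (K * P) ((3 * K + 2) * P) r⟩ := by
  set q := μ / (μ + σ) with hq
  let S₀ : Fin m → Finset (Fin (m * n)) := fun j =>
    (Finset.univ.filter fun a : Fin (m * n) => a.val / n = j.val).image (1 : Equiv.Perm (Fin (m * n)))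
  have hS₀ : ∀ φ : Fin (m * n) → Vec d, ∑ j, ∑ i ∈ S₀ j, φ i = ∑ i, φ i :=
    fun φ => sum_sum_block 1 φ
  have hinit : ∀ r : Fin (T * K * P) → Fin (m * n),
      ({ samples := fun j => (Finset.univ.filter fun ℓ : Fin (T * K * P) =>
          ℓ.val / nt = j).val.map r, active := 0, calls := 0, rounds := 0 } : Network (m * n))
        = netAt nt 0 0 0 r := by
    intro r
    have h1 : activeAt nt (T * K * P) 0 = 0 := by
      unfold activeAt
      split_ifs with h
      · exact Nat.zero_div _
      · rw [Nat.eq_zero_of_not_pos h, zero_add]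
        exact Nat.div_eq_of_lt (by omega)
    have h2 : remaining nt r 0 = fun j => (Finset.univ.filter fun ℓ : Fin (T * K * P) =>
          ℓ.val / nt = j).val.map r := by
      funext j
      simp [remaining]
    rw [netAt, h1, h2]
  have h := loop_simulation
    (body := fun _ => outerIteration f S₀ q σ η T K)
    (body' := fun _ => freshOuter f √q σ η T K)
    (fun p s => (PMF.uniformOfFintype (Fin (T * K * P) → Fin (m * n))).bind fun r =>
      PMF.pure ⟨s.1, s.2, √q, netAt nt (T * K * p) (K * p) ((3 * K + 2) * p) r⟩) P
    (fun p hp s => by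
      rw [PMF.bind_bind]
      simp only [PMF.pure_bind]
      rw [uniform_bind_outerIteration hnt f S₀ hS₀ hq0 hq1]
      · simp only [mul_add, mul_one]
      · have := Nat.mul_le_mul_left (T * K) (Nat.succ_le_of_lt hp)
        rwa [Nat.succ_eq_add_one, mul_add, mul_one] at this) (x0, x0) P le_rfl
  rw [PMF.bind_bind] at h
  simp only [PMF.pure_bind, mul_zero] at h
  rw [← h, ← uniform_bind_allocation]
  simp only [dasvrg, dataAllocation, PMF.bind_bind, PMF.pure_bind, ← hq, hinit]
  refine congrArg _ (funext fun π => congrArg _ (funext fun u => ?_))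
  rw [outerIteration_congr f (S' := S₀) fun φ => by rw [sum_sum_block, hS₀]]

end Allocation

end DASVRG

namespace DASVRG

/-! ### Expectations of nonnegative quantities along loops. -/

section Expectation

theorem expectation_pure {α : Type} (a : α) (g : α → ℝ≥0∞) : expectation (PMF.pure a) g = g a := by
  rw [expectation, tsum_eq_single a fun b hb => by rw [PMF.pure_apply_of_ne _ _ hb, zero_mul],
    PMF.pure_apply_self, one_mul]

theorem expectation_bind {α β : Type} (p : PMF α) (k : α → PMF β) (g : β → ℝ≥0∞) :
    expectation (p.bind k) g = expectation p fun a => expectation (k a) g := by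
  simp only [expectation, PMF.bind_apply, ← ENNReal.tsum_mul_right, ← ENNReal.tsum_mul_left]
  rw [ENNReal.tsum_comm]
  simp only [mul_assoc]

theorem expectation_mono {α : Type} (p : PMF α) {g g' : α → ℝ≥0∞} (h : ∀ a, g a ≤ g' a) :
    expectation p g ≤ expectation p g' :=
  ENNReal.tsum_le_tsum fun a => mul_le_mul_right (h a) _

theorem expectation_const {α : Type} (p : PMF α) (b : ℝ≥0∞) :
    expectation p (fun _ => b) = b := by
  rw [expectation, ENNReal.tsum_mul_right, PMF.tsum_coe, one_mul]

theorem expectation_add {α : Type} (p : PMF α) (g g' : α → ℝ≥0∞) :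
    expectation p (fun a => g a + g' a) = expectation p g + expectation p g' := by
  simp only [expectation, mul_add, ENNReal.tsum_add]

theorem expectation_const_mul {α : Type} (p : PMF α) (c : ℝ≥0∞) (g : α → ℝ≥0∞) :
    expectation p (fun a => c * g a) = c * expectation p g := by
  simp only [expectation, mul_left_comm _ c, ENNReal.tsum_mul_left]

theorem expectation_uniformOfFintype {N : ℕ} [NeZero N] {ψ : Fin N → ℝ} (hψ : ∀ i, 0 ≤ ψ i) :
    expectation (PMF.uniformOfFintype (Fin N)) (fun i => ENNReal.ofReal (ψ i)) =
      ENNReal.ofReal (1 / (N : ℝ) * ∑ i, ψ i) := by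
  have hN : (0 : ℝ) < N := Nat.cast_pos.2 (NeZero.pos N)
  rw [ENNReal.ofReal_mul (by positivity), ENNReal.ofReal_sum_of_nonneg fun i _ => hψ i, one_div,
    ENNReal.ofReal_inv_of_pos hN, ENNReal.ofReal_natCast]
  simp only [expectation, PMF.uniformOfFintype_apply, tsum_fintype, Fintype.card_fin,
    Finset.mul_sum]

theorem expectation_loop_le_add {α : Type} {body : ℕ → α → PMF α} {Φ : ℕ → α → ℝ≥0∞} {b : ℝ≥0∞}
    (h : ∀ n s, expectation (body n s) (Φ (n + 1)) ≤ Φ n s + b) (s : α) (n : ℕ) :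
    expectation (loop body n s) (Φ n) ≤ Φ 0 s + n * b := by
  induction n with
  | zero => simp [loop, expectation_pure]
  | succ n ih =>
    rw [loop, expectation_bind]
    refine (expectation_mono _ (h n)).trans ?_
    rw [expectation_add, expectation_const]
    refine (add_le_add_left ih b).trans (le_of_eq ?_)
    push_cast
    ring

theorem expectation_loop_le_mul {α : Type} {body : ℕ → α → PMF α} {Φ : α → ℝ≥0∞} {c : ℝ≥0∞}
    (h : ∀ n s, expectation (body n s) Φ ≤ c * Φ s) (s : α) (n : ℕ) :
    expectation (loop body n s) Φ ≤ c ^ n * Φ s := by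
  induction n with
  | zero => simp [loop, expectation_pure]
  | succ n ih =>
    rw [loop, expectation_bind]
    refine (expectation_mono _ (h n)).trans ?_
    rw [expectation_const_mul]
    refine (mul_le_mul_right ih c).trans (le_of_eq ?_)
    ring

end Expectation

/-! ### Expected contraction of stages and outer iterations. -/

section Convergence

variable {d N : ℕ} [NeZero N]

/-- A single stage contracts the expected optimality gap. -/
theorem expectation_freshStage_le {g : Fin N → Vec d → ℝ} {L μ η ρ : ℝ} {T : ℕ} {z : Vec d}
    (hg : SmoothConvexData g L) (hL : 0 < L) (hμ : 0 < μ) (hz : ∇ (objective g) z = 0)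
    (hgrowth : ∀ x, μ / 2 * ‖x - z‖ ^ 2 ≤ objective g x - objective g z)
    (hη : 0 < η) (hηL : 2 * L * η < 1) (hT : 0 < T) (hρ : 0 ≤ ρ)
    (hcontr : 2 / μ + 4 * L * η ^ 2 * T ≤ (2 * η - 4 * L * η ^ 2) * T * ρ) (x : Vec d) :
    expectation (freshStage g η T x)
        (fun x' => ENNReal.ofReal (objective g x' - objective g z)) ≤
      ENNReal.ofReal ρ * ENNReal.ofReal (objective g x - objective g z) := by
  set c := 2 * η - 4 * L * η ^ 2 with hc
  set D := objective g x - objective g z with hD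
  have hc0 : 0 < c := by rw [hc]; nlinarith
  have hcL : c * L ≤ 2 := by rw [hc]; nlinarith [sq_nonneg (L * η)]
  have hD0 : 0 ≤ D := sub_nonneg.2 (hg.objective_le hz x)
  have hT' : (0 : ℝ) < T := Nat.cast_pos.2 hT
  have hpos : ∀ (t : ℕ) (y a : Vec d), 0 ≤ svrgPotential g z c t y a := fun t y a =>
    (mul_nonneg hc0.le (mul_nonneg t.cast_nonneg (sub_nonneg.2 (hg.objective_le hz a)))).trans
      (hg.le_svrgPotential hz hc0.le hcL t y a)
  have h1 := expectation_loop_le_add (body := freshUpdate g x η)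
    (Φ := fun t s => ENNReal.ofReal (svrgPotential g z c t s.1 s.2))
    (b := ENNReal.ofReal (4 * L * η ^ 2 * D))
    (fun t s => by
      rw [freshUpdate, expectation_bind]
      simp only [expectation_pure]
      rw [expectation_uniformOfFintype fun i => hpos _ _ _,
        ← ENNReal.ofReal_add (hpos _ _ _) (by positivity)]
      exact ENNReal.ofReal_le_ofReal
        (hg.mean_svrgPotential_le hL hz x s.1 s.2 hη.le hηL.le t)) (x, 0) T
  -- At `t = 0` the average has weight zero, so its initial value `0` is immaterial.
  have h2 : svrgPotential g z c 0 x 0 ≤ 2 / μ * D := by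
    have h3 := hgrowth x
    have h4 : 2 / μ * (μ / 2 * ‖x - z‖ ^ 2) = ‖x - z‖ ^ 2 := by field_simp
    have h5 := mul_le_mul_of_nonneg_left h3 (by positivity : 0 ≤ 2 / μ)
    have h6 := mul_nonneg hc0.le hD0
    unfold svrgPotential
    rw [Nat.cast_zero, zero_mul, mul_zero, add_zero]
    linarith
  have h3 : ENNReal.ofReal (c * T) * expectation (freshStage g η T x)
      (fun x' => ENNReal.ofReal (objective g x' - objective g z)) ≤
      ENNReal.ofReal (c * T) * (ENNReal.ofReal ρ * ENNReal.ofReal D) := by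
    rw [← ENNReal.ofReal_mul hρ, ← ENNReal.ofReal_mul (by positivity), freshStage,
      expectation_bind, ← expectation_const_mul]
    simp only [expectation_pure]
    calc _ ≤ expectation (loop (freshUpdate g x η) T (x, 0))
            (fun s => ENNReal.ofReal (svrgPotential g z c T s.1 s.2)) := by
          refine expectation_mono _ fun s => ?_
          rw [← ENNReal.ofReal_mul (by positivity)]
          refine ENNReal.ofReal_le_ofReal ?_
          rw [mul_assoc]
          exact hg.le_svrgPotential hz hc0.le hcL T s.1 s.2
      _ ≤ _ := h1
      _ ≤ ENNReal.ofReal (2 / μ * D) + T * ENNReal.ofReal (4 * L * η ^ 2 * D) := by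
          gcongr
      _ ≤ _ := by
          rw [← ENNReal.ofReal_natCast, ← ENNReal.ofReal_mul hT'.le,
            ← ENNReal.ofReal_add (by positivity) (by positivity)]
          refine ENNReal.ofReal_le_ofReal ?_
          have := mul_le_mul_of_nonneg_right hcontr hD0
          linarith
  rwa [ENNReal.mul_le_mul_iff_right (ENNReal.ofReal_pos.2 (by positivity)).ne'
    ENNReal.ofReal_ne_top] at h3

/-- These are the parameters for contraction factor `1 / 2` on the proximal data, which are `(L +
σ)`-smooth with growth `μ + σ`. With `u = (L + σ) / L`, it comes down to `48 u - 16 - 18 u² ≥ 0` on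
`[1, 2]`. -/
theorem svrg_contraction_parameters {L μ σ η : ℝ} {T : ℕ} (hL : 0 < L) (hμ : 0 < μ) (hσ : 0 ≤ σ)
    (hσL : σ ≤ L) (hη : η = 1 / (16 * L)) (hT : 96 * ((L + σ) / (μ + σ)) ≤ T) :
    2 / (μ + σ) + 4 * (L + σ) * η ^ 2 * T ≤
      (2 * η - 4 * (L + σ) * η ^ 2) * T * (1 / 2) := by
  have h1 : 2 / (μ + σ) ≤ T / (48 * (L + σ)) := by
    rw [le_div_iff₀ (by positivity)]
    have e : 2 / (μ + σ) * (48 * (L + σ)) = 96 * ((L + σ) / (μ + σ)) := by ring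
    rwa [e]
  have h2 : 1 / (48 * (L + σ)) + 6 * (L + σ) * η ^ 2 ≤ η := by
    have e : η - (1 / (48 * (L + σ)) + 6 * (L + σ) * η ^ 2)
        = (48 * L * (L + σ) - 16 * L ^ 2 - 18 * (L + σ) ^ 2) / (768 * L ^ 2 * (L + σ)) := by
      rw [hη]; field_simp; ring
    have h3 : 0 ≤ 48 * L * (L + σ) - 16 * L ^ 2 - 18 * (L + σ) ^ 2 := by nlinarith
    have h4 : 0 ≤ (48 * L * (L + σ) - 16 * L ^ 2 - 18 * (L + σ) ^ 2) / (768 * L ^ 2 * (L + σ)) :=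
      div_nonneg h3 (by positivity)
    linarith
  have h3 := mul_le_mul_of_nonneg_left h2 (Nat.cast_nonneg T : (0 : ℝ) ≤ T)
  have e : (T : ℝ) * (1 / (48 * (L + σ)) + 6 * (L + σ) * η ^ 2)
      = T / (48 * (L + σ)) + 6 * (L + σ) * η ^ 2 * T := by ring
  rw [e] at h3
  linarith

variable {f : Fin N → Vec d → ℝ} {L μ σ η a : ℝ} {T K : ℕ} {xs : Vec d}

/-- An outer iteration contracts the expected potential. -/
theorem expectation_freshOuter_le (hf : SmoothConvexData f L) (hL : 0 < L) (hμ : 0 < μ)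
    (hexp : ∀ x y, μ * ‖x - y‖ ≤ ‖∇ (objective f) x - ∇ (objective f) y‖)
    (hmin : ∀ x, objective f xs ≤ objective f x)
    (hσ0 : 0 < σ) (hσL : σ ≤ L) (ha0 : 0 < a) (ha1 : a < 1) (hσ : σ = μ * (1 - a ^ 2) / a ^ 2)
    (hη : η = 1 / (16 * L)) (hT : 96 * ((L + σ) / (μ + σ)) ≤ T)
    (hK : (1 / 2 : ℝ) ^ K ≤ a ^ 2 / 48) (s : Vec d × Vec d) :
    expectation (freshOuter f a σ η T K s)
        (fun s' => ENNReal.ofReal (proxPotential (objective f) μ a xs s'.1 s'.2)) ≤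
      ENNReal.ofReal (1 - a / 4) *
        ENNReal.ofReal (proxPotential (objective f) μ a xs s.1 s.2) := by
  obtain ⟨x, y⟩ := s
  set g := proxData f σ y with hgdef
  have hg : SmoothConvexData g (L + σ) := hf.proxData hσ0.le y
  have hSC := hf.strongConvexity hμ hexp hmin
  have hB : ∇ (objective f) xs = 0 := gradient_eq_zero_of_forall_le hmin
  obtain ⟨z, hz⟩ := exists_isMinOn_add_sq hf.differentiable_objective.continuous hmin hσ0 y
  have hobj : objective g = fun x => objective f x + σ / 2 * ‖x - y‖ ^ 2 :=
    funext fun x => objective_proxData f σ y x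
  have hgz : ∇ (objective g) z = 0 := gradient_eq_zero_of_forall_le (by rw [hobj]; exact hz)
  have hz0 : ∇ (objective f) z + σ • (z - y) = 0 := by
    rw [← hgz, hobj, (hasGradientAt_add_sq hf.differentiable_objective σ y z).gradient]
  have hgrowth : ∀ x, (μ + σ) / 2 * ‖x - z‖ ^ 2 ≤ objective g x - objective g z := by
    rw [hobj]
    exact add_sq_sub_ge_of_prox hSC hz0
  have hTpos : 0 < T := by
    rw [← Nat.cast_pos (α := ℝ)]
    exact lt_of_lt_of_le (by positivity) hT
  set V := proxPotential (objective f) μ a xs x y with hV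
  have hV0 : 0 ≤ V := (sub_nonneg.2 (hmin x)).trans (sub_le_proxPotential hμ ha1 x y)
  have hη0 : 0 < η := by rw [hη]; positivity
  have hηL : 2 * (L + σ) * η < 1 := by
    rw [hη, mul_one_div, div_lt_one (by positivity)]
    linarith
  have h1 := expectation_loop_le_mul (body := fun _ => freshStage g η T)
    (Φ := fun x' => ENNReal.ofReal (objective g x' - objective g z))
    (fun _ => expectation_freshStage_le hg (by positivity) (by positivity) hgz hgrowth hη0 hηL
      hTpos (by norm_num) (svrg_contraction_parameters hL hμ hσ0.le hσL hη hT)) x K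
  have h2 : objective g x - objective g z ≤ 4 * V := by
    rw [hobj]
    exact prox_gap_le hSC hB hmin hμ ha0 ha1 hσ x y z
  have h3 : ENNReal.ofReal (1 / 2) ^ K * ENNReal.ofReal (objective g x - objective g z) ≤
      ENNReal.ofReal (a ^ 2 / 12 * V) := by
    rw [← ENNReal.ofReal_pow (by norm_num), ← ENNReal.ofReal_mul (by positivity)]
    refine ENNReal.ofReal_le_ofReal ?_
    have h4 : 0 ≤ objective g x - objective g z := sub_nonneg.2 (hg.objective_le hgz x)
    calc _ ≤ a ^ 2 / 48 * (4 * V) := by gcongr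
      _ = _ := by ring
  rw [freshOuter, expectation_bind]
  simp only [expectation_pure]
  calc _ ≤ expectation (loop (fun _ => freshStage g η T) K x) (fun x' =>
          ENNReal.ofReal ((1 - a / 2) * V)
            + ENNReal.ofReal (3 / a) * ENNReal.ofReal (objective g x' - objective g z)) := by
        refine expectation_mono _ fun x' => ?_
        have h4 : 0 ≤ objective g x' - objective g z := sub_nonneg.2 (hg.objective_le hgz x')
        rw [← ENNReal.ofReal_mul (by positivity), ← ENNReal.ofReal_add
          (mul_nonneg (by linarith) hV0) (by positivity)]
        refine ENNReal.ofReal_le_ofReal ?_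
        rw [hobj]
        exact proxPotential_next_le hSC hmin hμ ha0 ha1 hσ hz0 x'
    _ ≤ ENNReal.ofReal ((1 - a / 2) * V)
          + ENNReal.ofReal (3 / a) * ENNReal.ofReal (a ^ 2 / 12 * V) := by
        rw [expectation_add, expectation_const, expectation_const_mul]
        gcongr
        exact h1.trans h3
    -- `(1 - a / 2) + (3 / a) * (a ^ 2 / 12) = 1 - a / 4`.
    _ = _ := by
        rw [← ENNReal.ofReal_mul (by positivity), ← ENNReal.ofReal_mul (by linarith),
          ← ENNReal.ofReal_add (mul_nonneg (by linarith) hV0) (by positivity)]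
        congr 1
        field_simp
        ring

theorem expectation_loop_freshOuter_le (hf : SmoothConvexData f L) (hL : 0 < L) (hμ : 0 < μ)
    (hexp : ∀ x y, μ * ‖x - y‖ ≤ ‖∇ (objective f) x - ∇ (objective f) y‖)
    (hmin : ∀ x, objective f xs ≤ objective f x)
    (hσ0 : 0 < σ) (hσL : σ ≤ L) (ha0 : 0 < a) (ha1 : a < 1) (hσ : σ = μ * (1 - a ^ 2) / a ^ 2)
    (hη : η = 1 / (16 * L)) (hT : 96 * ((L + σ) / (μ + σ)) ≤ T)
    (hK : (1 / 2 : ℝ) ^ K ≤ a ^ 2 / 48) (P : ℕ) (x0 : Vec d) :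
    expectation (loop (fun _ => freshOuter f a σ η T K) P (x0, x0))
        (fun s => ENNReal.ofReal (objective f s.1 - objective f xs)) ≤
      ENNReal.ofReal ((1 - a / 4) ^ P * (2 * (objective f x0 - objective f xs))) := by
  have hSC := hf.strongConvexity hμ hexp hmin
  have hB : ∇ (objective f) xs = 0 := gradient_eq_zero_of_forall_le hmin
  have h1 := expectation_loop_le_mul (body := fun _ => freshOuter f a σ η T K)
    (Φ := fun s => ENNReal.ofReal (proxPotential (objective f) μ a xs s.1 s.2))
    (fun _ => expectation_freshOuter_le hf hL hμ hexp hmin hσ0 hσL ha0 ha1 hσ hη hT hK) (x0, x0) P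
  refine le_trans (expectation_mono _ fun s => ?_) (h1.trans ?_)
  · exact ENNReal.ofReal_le_ofReal (sub_le_proxPotential hμ ha1 s.1 s.2)
  rw [ENNReal.ofReal_mul (pow_nonneg (by linarith) _), ENNReal.ofReal_pow (by linarith)]
  gcongr
  exact proxPotential_self_le hSC hB hμ ha0 x0

end Convergence

/-! ### Numerical bounds on `K`, on the changes of machine and on the number of outer iterations. -/

section Parameters

/-- The prescribed `K` gives `X ≤ (9 / 8) ^ K`, while the stages contract by `1 / 2`. As `(9 / 8) ^
5 ≤ 2`, it is enough that `X ^ 5 ≥ 48 / q`: the second summand of `X` gives this for `q ≤ 1 / 2`,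
the first one for `q > 1 / 2`. -/
theorem half_pow_ceil_le {q s : ℝ} (hs : 0 < s) (hq : q = 1 / (1 + s)) {K : ℕ}
    (hK : 1 / Real.log (9 / 8) *
      Real.log (4 / (2 - √q) + 10368 * (s / (q * (1 - √q / 2) ^ 2))) ≤ K) :
    (1 / 2 : ℝ) ^ K ≤ q / 48 := by
  have hq0 : 0 < q := by rw [hq]; positivity
  have hq1 : q < 1 := by rw [hq, div_lt_one (by positivity)]; linarith
  have hr0 : 0 < √q := Real.sqrt_pos.2 hq0
  have hr1 : √q < 1 := by rw [← Real.sqrt_one]; exact Real.sqrt_lt_sqrt hq0.le hq1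
  have hrq := Real.sq_sqrt hq0.le
  set X := 4 / (2 - √q) + 10368 * (s / (q * (1 - √q / 2) ^ 2)) with hX
  have h1 : 0 < 4 / (2 - √q) := div_pos (by norm_num) (by linarith)
  have hden : 0 < q * (1 - √q / 2) ^ 2 := mul_pos hq0 (pow_pos (by linarith) 2)
  have h2 : 0 < s / (q * (1 - √q / 2) ^ 2) := div_pos hs hden
  have hX0 : 0 < X := by positivity
  have hlog : 0 < Real.log (9 / 8) := Real.log_pos (by norm_num)
  have h3 : X ≤ (9 / 8 : ℝ) ^ K := by
    rw [← Real.log_le_log_iff hX0 (by positivity), Real.log_pow]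
    rwa [one_div, inv_mul_le_iff₀ hlog, mul_comm] at hK
  have h4 : 48 / q ≤ X ^ 5 := by
    rcases le_or_gt q (1 / 2) with h | h
    · have hs1 : 1 ≤ s := by
        rw [hq, div_le_div_iff₀ (by positivity) (by norm_num)] at h
        linarith
      have h5 : 1 / q ≤ s / (q * (1 - √q / 2) ^ 2) := by
        refine div_le_div₀ hs.le hs1 hden ?_
        refine mul_le_of_le_one_right hq0.le (pow_le_one₀ (by linarith) (by linarith))
      have h6 : 48 / q = 48 * (1 / q) := by ring
      have h7 : 1 ≤ 1 / q := by rw [le_div_iff₀ hq0]; linarith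
      have h8 : 1 ≤ X := by linarith
      have h9 : X ≤ X ^ 5 := le_self_pow₀ h8 (by norm_num)
      linarith
    · have hr : 7 / 10 ≤ √q := by
        rw [Real.le_sqrt (by norm_num) hq0.le]; linarith
      have h5 : 3 ≤ X := by
        have : 3 ≤ 4 / (2 - √q) := by rw [le_div_iff₀ (by linarith)]; linarith
        linarith
      have h6 : (3 : ℝ) ^ 5 ≤ X ^ 5 := by gcongr
      have h7 : 48 / q ≤ 96 := by rw [div_le_iff₀ hq0]; linarith
      linarith
  have h5 : 48 / q ≤ (2 : ℝ) ^ K := by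
    calc 48 / q ≤ X ^ 5 := h4
      _ ≤ ((9 / 8 : ℝ) ^ K) ^ 5 := by gcongr
      _ = ((9 / 8 : ℝ) ^ 5) ^ K := by rw [← pow_mul, ← pow_mul, mul_comm]
      _ ≤ 2 ^ K := by
        refine pow_le_pow_left₀ (by norm_num) (by norm_num) K
  rw [one_div, inv_pow, inv_le_comm₀ (by positivity) (by positivity), inv_div]
  exact h5

theorem ceil_stages_le {q s : ℝ} (hs : 0 < s) (hq : q = 1 / (1 + s)) :
    ((⌈1 / Real.log (9 / 8) *
      Real.log (4 / (2 - √q) + 10368 * (s / (q * (1 - √q / 2) ^ 2)))⌉₊ : ℕ) : ℝ) ≤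
      400000 * (1 + Real.log (1 + s)) := by
  have hq0 : 0 < q := by rw [hq]; positivity
  have hq1 : q < 1 := by rw [hq, div_lt_one (by positivity)]; linarith
  have hr0 : 0 < √q := Real.sqrt_pos.2 hq0
  have hr1 : √q < 1 := by rw [← Real.sqrt_one]; exact Real.sqrt_lt_sqrt hq0.le hq1
  set X := 4 / (2 - √q) + 10368 * (s / (q * (1 - √q / 2) ^ 2)) with hX
  have h1 : 1 ≤ 4 / (2 - √q) := by rw [le_div_iff₀ (by linarith)]; linarith
  have h1' : 4 / (2 - √q) ≤ 4 := div_le_self (by norm_num) (by linarith)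
  have hden : 0 < q * (1 - √q / 2) ^ 2 := mul_pos hq0 (pow_pos (by linarith) 2)
  have h2 : 0 < s / (q * (1 - √q / 2) ^ 2) := div_pos hs hden
  have h3 : s / (q * (1 - √q / 2) ^ 2) ≤ 4 * (s * (1 + s)) := by
    rw [div_le_iff₀ hden]
    have h4 : (1 / 2 : ℝ) ^ 2 ≤ (1 - √q / 2) ^ 2 := by gcongr; linarith
    have h5 : (1 + s) * q = 1 := by rw [hq]; field_simp
    have h6 : 4 * (s * (1 + s)) * (q * (1 - √q / 2) ^ 2)
        = 4 * s * ((1 + s) * q) * (1 - √q / 2) ^ 2 := by ring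
    rw [h6, h5]
    nlinarith
  have hX1 : 1 ≤ X := by linarith
  have hX2 : X ≤ 41472 * (1 + s) ^ 2 := by nlinarith
  have hlogX : Real.log X ≤ 41472 + 2 * Real.log (1 + s) := by
    calc Real.log X ≤ Real.log (41472 * (1 + s) ^ 2) := Real.log_le_log (by linarith) hX2
      _ = Real.log 41472 + 2 * Real.log (1 + s) := by
        rw [Real.log_mul (by norm_num) (by positivity), Real.log_pow]; norm_num
      _ ≤ _ := by gcongr; exact Real.log_le_self (by norm_num)
  have hlog9 : 1 / 9 ≤ Real.log (9 / 8) := by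
    have := Real.one_sub_inv_le_log_of_pos (by norm_num : (0 : ℝ) < 9 / 8)
    norm_num at this ⊢
    exact this
  have h4 : 1 / Real.log (9 / 8) ≤ 9 := by
    rw [div_le_iff₀ (by linarith)]; linarith
  have h5 : 0 ≤ Real.log X := Real.log_nonneg hX1
  have h6 : 1 / Real.log (9 / 8) * Real.log X ≤ 9 * Real.log X := by gcongr
  have h7 := (Nat.ceil_lt_add_one (mul_nonneg (by positivity) h5 :
    0 ≤ 1 / Real.log (9 / 8) * Real.log X)).le
  have h8 : 0 ≤ Real.log (1 + s) := Real.log_nonneg (by linarith)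
  linarith

theorem activeAt_self_le {nt : ℕ} (hnt : 0 < nt) (Q : ℕ) :
    (activeAt nt Q Q : ℝ) ≤ Q / nt + 1 := by
  have h1 : activeAt nt Q Q = (Q + nt - 1) / nt := by simp [activeAt]
  have hnt' : (0 : ℝ) < nt := Nat.cast_pos.2 hnt
  rw [h1]
  refine Nat.cast_div_le.trans ?_
  rw [div_add_one hnt'.ne']
  gcongr
  have : ((Q + nt - 1 : ℕ) : ℝ) ≤ ((Q + nt : ℕ) : ℝ) := by exact_mod_cast Nat.sub_le _ _
  push_cast at this
  exact this

theorem pow_mul_le_of_ceil_le {a D ε : ℝ} (ha0 : 0 < a) (ha1 : a < 1) (hD : 0 ≤ D) (hε : 0 < ε)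
    {P : ℕ} (hP : 4 / a * (1 + Real.posLog (D / ε)) ≤ P) :
    (1 - a / 4) ^ P * (2 * D) ≤ ε := by
  rcases hD.eq_or_lt with rfl | hD
  · simpa using hε.le
  have h1 : (1 - a / 4) ^ P ≤ Real.exp (-(1 + Real.posLog (D / ε))) := by
    calc (1 - a / 4) ^ P ≤ Real.exp (-(a / 4)) ^ P := by
          gcongr
          · linarith
          · exact Real.one_sub_le_exp_neg _
      _ = Real.exp (-(a / 4 * P)) := by rw [← Real.exp_nat_mul]; congr 1; ring
      _ ≤ _ := by
        refine Real.exp_le_exp.2 (neg_le_neg ?_)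
        rw [div_mul_eq_mul_div, div_le_iff₀ ha0] at hP
        linarith
  have h2 : D / ε ≤ Real.exp (Real.posLog (D / ε)) := by
    calc D / ε = Real.exp (Real.log (D / ε)) := (Real.exp_log (by positivity)).symm
      _ ≤ _ := Real.exp_le_exp.2 (le_max_right _ _)
  -- The `1` in `1 + log⁺` pays for the factor `2` of the initial potential.
  have h3 : (2 : ℝ) ≤ Real.exp 1 := by linarith [Real.add_one_le_exp (1 : ℝ)]
  have h4 : 2 * (D / ε) ≤ Real.exp (1 + Real.posLog (D / ε)) := by
    rw [Real.exp_add]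
    gcongr
  calc (1 - a / 4) ^ P * (2 * D) ≤ Real.exp (-(1 + Real.posLog (D / ε))) * (2 * D) := by gcongr
    _ = Real.exp (-(1 + Real.posLog (D / ε))) * (2 * (D / ε)) * ε := by field_simp
    _ ≤ Real.exp (-(1 + Real.posLog (D / ε))) * Real.exp (1 + Real.posLog (D / ε)) * ε := by gcongr
    _ = ε := by rw [← Real.exp_add]; simp

end Parameters

end DASVRG

/-! ### Assembly of the main theorem. -/

set_option maxHeartbeats 2000000 in
theorem mainTheorem3 :
    ∃ A : ℝ, 0 < A ∧ ∀ c : ℝ, 0 < c → ∃ B : ℝ, 0 < B ∧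
      ∀ (d m n Cmem : ℕ) [NeZero m] [NeZero n],
        n < Cmem → Cmem < m * n → c * (n : ℝ) ≤ ((Cmem - n : ℕ) : ℝ) →
      ∀ (f : Fin (m * n) → DASVRG.Vec d → ℝ) (L μ : ℝ), 0 < L → 0 < μ →
        (∀ i, ConvexOn ℝ Set.univ (f i)) →
        (∀ i, Differentiable ℝ (f i)) →
        (∀ i x y, ‖gradient (f i) x - gradient (f i) y‖ ≤ L * ‖x - y‖) →
        (∀ x y, μ * ‖x - y‖ ≤
          ‖gradient (DASVRG.objective f) x - gradient (DASVRG.objective f) y‖) →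
      ∀ x0 xstar : DASVRG.Vec d, (∀ x, DASVRG.objective f xstar ≤ DASVRG.objective f x) →
      ∀ (κ σ η q : ℝ) (T K : ℕ),
        κ = L / μ →
        σ = L / n →
        η = 1 / (16 * L) →
        q = μ / (μ + σ) →
        T = ⌈96 * ((L + σ) / (μ + σ))⌉₊ →
        K = ⌈1 / Real.log (9 / 8) *
              Real.log (4 / (2 - √q) + 10368 * σ / (μ * q * (1 - √q / 2) ^ 2))⌉₊ →
      ∀ ε : ℝ, 0 < ε → ∀ bound : ℝ,
        bound = (1 + √(κ / n)) * (1 + Real.log (1 + κ / n)) *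
          (1 + Real.posLog ((DASVRG.objective f x0 - DASVRG.objective f xstar) / ε)) →
      ∃ P₀ : ℕ,
        (K * P₀ : ℝ) ≤ A * bound ∧
        (∀ P : ℕ, P₀ ≤ P → T * K * P ≤ (Cmem - n) * m →
          DASVRG.expectation (DASVRG.dasvrg f (Cmem - n) μ σ η T K P x0)
            (fun s => ENNReal.ofReal (DASVRG.objective f s.x - DASVRG.objective f xstar)) ≤
            ENNReal.ofReal ε) ∧
        (T * K * P₀ ≤ (Cmem - n) * m →
          ∀ s ∈ (DASVRG.dasvrg f (Cmem - n) μ σ η T K P₀ x0).support,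
            s.net.calls = K * P₀ ∧ (s.net.rounds : ℝ) ≤ B * bound) := by
  -- `2000000 = 400000 * 5` combines the bounds on `K` and `P₀`. In `6 + 193 / c`, `3 K P₀` rounds
  -- come from the stages, `2 P₀ ≤ 2 K P₀` from the outer iterations, and at most `(193 / c) K P₀ +
  -- 1` from changes of machine.
  refine ⟨2000000, by norm_num, fun c hc => ⟨2000000 * (6 + 193 / c), by positivity, ?_⟩⟩
  intro d m n Cmem _ _ hnC hCN hcn f L μ hL hμ hconv hdiff hlip hexp x0 xstar hmin κ σ η q T K
    hκ hσ hη hq hT hK ε hε bound hbound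
  have hf : DASVRG.SmoothConvexData f L := ⟨hconv, hdiff, hlip⟩
  have hn1 : (1 : ℝ) ≤ n := by exact_mod_cast NeZero.one_le
  have hn0 : (0 : ℝ) < n := by linarith
  have hnt : 0 < Cmem - n := Nat.sub_pos_of_lt hnC
  have hσ0 : 0 < σ := by rw [hσ]; positivity
  have hσL : σ ≤ L := by rw [hσ]; exact div_le_self hL.le hn1
  set s := κ / n with hs
  have hsσ : s = σ / μ := by rw [hs, hκ, hσ]; field_simp
  have hs0 : 0 < s := by rw [hsσ]; positivity
  have hqs : q = 1 / (1 + s) := by rw [hq, hsσ]; field_simp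
  have hq0 : 0 < q := by rw [hqs]; positivity
  have hq1 : q < 1 := by rw [hqs, div_lt_one (by positivity)]; linarith
  have ha0 : 0 < √q := Real.sqrt_pos.2 hq0
  have ha1 : √q < 1 := by rw [← Real.sqrt_one]; exact Real.sqrt_lt_sqrt hq0.le hq1
  have hK' : K = ⌈1 / Real.log (9 / 8) *
      Real.log (4 / (2 - √q) + 10368 * (s / (q * (1 - √q / 2) ^ 2)))⌉₊ := by
    have e : 10368 * σ / (μ * q * (1 - √q / 2) ^ 2) = 10368 * (s / (q * (1 - √q / 2) ^ 2)) := by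
      rw [hsσ, mul_div_assoc, div_div, mul_assoc]
    rw [hK, e]
  have hKδ : (1 / 2 : ℝ) ^ K ≤ √q ^ 2 / 48 := by
    rw [Real.sq_sqrt hq0.le]
    refine DASVRG.half_pow_ceil_le hs0 hqs ?_
    rw [hK']
    exact Nat.le_ceil _
  have hKle : (K : ℝ) ≤ 400000 * (1 + Real.log (1 + s)) := by
    rw [hK']
    exact DASVRG.ceil_stages_le hs0 hqs
  have hK1 : 1 ≤ K := by
    rw [Nat.one_le_iff_ne_zero]
    rintro rfl
    rw [Real.sq_sqrt hq0.le] at hKδ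
    linarith
  have hTle : 96 * ((L + σ) / (μ + σ)) ≤ T := by rw [hT]; exact Nat.le_ceil _
  have hTn : (T : ℝ) ≤ 193 * n := by
    -- `L = n σ` gives `L + σ = (n + 1) σ`; then `96 (n + 1) + 1 ≤ 193 n`.
    have h1 : (L + σ) / (μ + σ) ≤ n + 1 := by
      rw [div_le_iff₀ (by positivity)]
      have h2 : L = n * σ := by rw [hσ]; field_simp
      nlinarith
    have h2 := (Nat.ceil_lt_add_one (by positivity : 0 ≤ 96 * ((L + σ) / (μ + σ)))).le
    rw [← hT] at h2
    linarith
  have hσq : σ = μ * (1 - √q ^ 2) / √q ^ 2 := by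
    rw [Real.sq_sqrt hq0.le, hq]
    field_simp
    ring
  set D := DASVRG.objective f x0 - DASVRG.objective f xstar with hD
  have hD0 : 0 ≤ D := sub_nonneg.2 (hmin x0)
  set ℓ := Real.posLog (D / ε) with hℓ
  have hℓ0 : 0 ≤ ℓ := Real.posLog_nonneg
  have hlaw : ∀ P, DASVRG.dasvrg f (Cmem - n) μ σ η T K P x0 = _ := fun P =>
    DASVRG.dasvrg_eq f hnt (by rwa [← hq]) (by rwa [← hq]) η T K P x0
  set P₀ := ⌈4 / √q * (1 + ℓ)⌉₊ with hP₀
  have hinv : 1 / √q ≤ 1 + √s := by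
    rw [hqs, Real.sqrt_div zero_le_one, Real.sqrt_one, one_div_one_div]
    refine (Real.sqrt_le_left (by positivity)).2 ?_
    nlinarith [Real.sq_sqrt hs0.le, Real.sqrt_nonneg s]
  have hP₀le : (P₀ : ℝ) ≤ 5 * ((1 + √s) * (1 + ℓ)) := by
    have h1 := (Nat.ceil_lt_add_one (by positivity : 0 ≤ 4 / √q * (1 + ℓ))).le
    have h2 : 4 / √q * (1 + ℓ) = 4 * (1 / √q * (1 + ℓ)) := by ring
    have h3 : 1 / √q * (1 + ℓ) ≤ (1 + √s) * (1 + ℓ) := by gcongr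
    have h4 : 1 ≤ (1 + √s) * (1 + ℓ) := by nlinarith [Real.sqrt_nonneg s]
    linarith
  have hlog0 : 0 ≤ Real.log (1 + s) := Real.log_nonneg (by linarith)
  have hKP : (K * P₀ : ℝ) ≤ 2000000 * bound := by
    calc (K * P₀ : ℝ) ≤ 400000 * (1 + Real.log (1 + s)) * (5 * ((1 + √s) * (1 + ℓ))) := by gcongr
      _ = 2000000 * bound := by rw [hbound]; ring
  have hP₀1 : 1 ≤ P₀ := Nat.one_le_iff_ne_zero.2 (Nat.ceil_pos.2 (by positivity)).ne'
  refine ⟨P₀, hKP, fun P hP _ => ?_, fun _ w hw => ?_⟩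
  · rw [hlaw P, DASVRG.expectation_bind]
    simp only [DASVRG.expectation_bind, DASVRG.expectation_pure, DASVRG.expectation_const, ← hq]
    refine (DASVRG.expectation_loop_freshOuter_le hf hL hμ hexp hmin hσ0 hσL ha0 ha1 hσq hη hTle
      hKδ P x0).trans (ENNReal.ofReal_le_ofReal ?_)
    refine DASVRG.pow_mul_le_of_ceil_le ha0 ha1 hD0 hε ((Nat.le_ceil _).trans ?_)
    exact_mod_cast hP
  · rw [hlaw P₀] at hw
    simp only [PMF.mem_support_bind_iff, PMF.mem_support_pure_iff] at hw
    obtain ⟨x, -, r, -, rfl⟩ := hw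
    refine ⟨rfl, ?_⟩
    have h1 := DASVRG.activeAt_self_le hnt (T * K * P₀)
    have hKP1 : (1 : ℝ) ≤ K * P₀ := by exact_mod_cast Nat.mul_le_mul hK1 hP₀1
    have hPKP : (P₀ : ℝ) ≤ K * P₀ := by
      exact_mod_cast Nat.le_mul_of_pos_left P₀ hK1
    have hnt' : (0 : ℝ) < ((Cmem - n : ℕ) : ℝ) := Nat.cast_pos.2 hnt
    have h2 : ((T * K * P₀ : ℕ) : ℝ) / ((Cmem - n : ℕ) : ℝ) ≤ 193 / c * (K * P₀) := by
      rw [div_le_iff₀ hnt']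
      calc ((T * K * P₀ : ℕ) : ℝ) = T * (K * P₀) := by push_cast; ring
        _ ≤ 193 * n * (K * P₀) := by gcongr
        _ = 193 / c * (K * P₀) * (c * n) := by field_simp
        _ ≤ _ := by gcongr
    have h3 : (((DASVRG.netAt (Cmem - n) (T * K * P₀) (K * P₀) ((3 * K + 2) * P₀) r).rounds : ℕ) : ℝ)
        = (3 * K + 2) * P₀ + DASVRG.activeAt (Cmem - n) (T * K * P₀) (T * K * P₀) := by
      simp only [DASVRG.netAt]
      push_cast
      ring
    rw [h3]
    calc (3 * K + 2) * (P₀ : ℝ) + DASVRG.activeAt (Cmem - n) (T * K * P₀) (T * K * P₀)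
        ≤ (6 + 193 / c) * (K * P₀) := by linarith
      _ ≤ (6 + 193 / c) * (2000000 * bound) := by gcongr
      _ = _ := by ring
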